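/- Let $y\in\mathbb R^4$, $y\neq 0$, $a=|y|$, $\hat y=y/a$. For $x\in\mathbb R^4$ let $\gamma=\gamma(x+iy)=\sqrt{(x+iy)\cdot(x+iy)}=\sqrt{|x|^2-a^2+2i\,x\cdot y}$ be the complex length, with the branch $p=\operatorname{Re}\gamma\ge 0$; let $$\phi(x+iy)=-\frac1{4\pi^2\gamma^2},\qquad \phi_\varepsilon=\theta(p-\varepsilon)\,\phi\quad(\varepsilon>0),$$ where $\theta$ is the unit step function. As functions of $x\in\mathbb R^4$, $\phi$ and all $\phi_\varepsilon$ are locally integrable. The source distribution $$\tilde\delta(x+iy)=-\Delta_x\frac{1}{4\pi^2\gamma^2},\qquad \langle\tilde\delta,g\rangle=\lim_{\varepsilon\to0^+}\langle\Delta\phi_\varepsilon,g\rangle=\lim_{\varepsilon\to 0^+}\int_{\mathbb R^4}\phi_\varepsilon\,\Delta g\,dx\qquad(g\in C_c^\infty(\mathbb R^4)),$$ exists, is the distributional Laplacian of $\phi$ (that is, $\langle\tilde\delta,g\rangle=\int\phi\,\Delta g\,dx$ for all $g\in C_c^\infty(\mathbb R^4)$), and extends in exactly one way to a bounded linear functional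 on $C^1(\mathbb R^4)$ (complex-valued functions; bounded by a constant times the supremum of $|f|$ and $|Df|$ over some compact set). For every $f\in C^1(\mathbb R^4)$ put $$\bar f(\rho,\zeta)=\int_{S^2} f(\rho\,\sigma+\zeta\,\hat y)\,d\sigma,$$ where $S^2$ is the unit sphere of the hyperplane orthogonal to $y$ and $d\sigma$ its normalized surface measure ($\int_{S^2}d\sigma=1$). Then the partial derivatives $\bar f_\rho(a,0)$ and $\bar f_\zeta(a,0)$ exist and $$\langle\tilde\delta,f\rangle=\bar f(a,0)+a\,\bar f_\rho(a,0)-i\,a\,\bar f_\zeta(a,0).$$ -/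

import Mathlib

open MeasureTheory Filter Topology
open scoped ContDiff InnerProductSpace

noncomputable section

namespace ComplexSource

/-- The Euclidean space `ℝ⁴`. -/
abbrev R4 : Type := EuclideanSpace ℝ (Fin 4)

/-- The complex square `z² = ∑ⱼ zⱼ²` of `z = x + i y ∈ ℂ⁴`. -/
def complexSq (y x : R4) : ℂ := ∑ j, ((x j : ℂ) + Complex.I * (y j : ℂ)) ^ 2

/-- The complex length `γ(x + i y) = √(z²)`, with the branch of the root whose real part is
nonnegative (Mathlib's principal square root). -/
def complexLength (y x : R4) : ℂ := Complex.sqrt (complexSq y x)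

/-- The holomorphic potential `φ(x + i y) = -1 / (4 π² γ²)`, as a function of `x` for fixed `y`.
(The value `0` that division gives on the null set `γ = 0` is immaterial.) -/
def potential (y x : R4) : ℂ := -(1 / (4 * (Real.pi : ℂ) ^ 2 * complexLength y x ^ 2))

open Classical in
/-- The regularized potential `φ_ε = θ(p - ε) φ`, where `p = Re γ` and `θ` is the unit step. -/
def regPotential (y : R4) (ε : ℝ) (x : R4) : ℂ :=
  if ε < (complexLength y x).re then potential y x else 0

/-- The pairing `⟨Δu, g⟩ = ∫ u Δg` of the distributional Laplacian of a locally integrable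
function `u` with a test function `g`. -/
def laplacianPairing (u g : R4 → ℂ) : ℂ := ∫ x, u x * Laplacian.laplacian g x

/-- The complex vector space `C¹(ℝ⁴)` of continuously differentiable complex functions. -/
def C1 : Submodule ℂ (R4 → ℂ) where
  carrier := {f | ContDiff ℝ 1 f}
  add_mem' {f g} hf hg := by
    have hf' : ContDiff ℝ 1 f := hf
    have hg' : ContDiff ℝ 1 g := hg
    exact hf'.add hg'
  zero_mem' := by
    show ContDiff ℝ 1 (fun _ : R4 => (0 : ℂ))
    exact contDiff_const
  smul_mem' c f hf := by
    have hf' : ContDiff ℝ 1 f := hf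
    exact contDiff_const.smul hf'

/-- A linear functional on `C¹(ℝ⁴)` is bounded when it is bounded by the `C¹` seminorm of some
compact set, i.e. continuous for the locally uniform convergence of `f` and `Df`. -/
def IsBoundedOnC1 (T : C1 →ₗ[ℂ] ℂ) : Prop :=
  ∃ K : Set R4, IsCompact K ∧ ∃ C : ℝ, ∀ (f : C1) (M : ℝ),
    (∀ x ∈ K, ‖(f : R4 → ℂ) x‖ ≤ M) → (∀ x ∈ K, ‖fderiv ℝ (f : R4 → ℂ) x‖ ≤ M) →
      ‖T f‖ ≤ C * M

/-- `T` is the source distribution `δ̃(x + i y)`, as a bounded linear functional on `C¹(ℝ⁴)`: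
on the test functions `g` of class `C^∞` with compact support it is the limit
`⟨δ̃, g⟩ = lim_{ε → 0⁺} ⟨Δφ_ε, g⟩` of the distributional Laplacians of the regularized
potentials. -/
structure IsSourceDistribution (y : R4) (T : C1 →ₗ[ℂ] ℂ) : Prop where
  bounded : IsBoundedOnC1 T
  tendsto : ∀ g : C1, ContDiff ℝ ∞ (g : R4 → ℂ) → HasCompactSupport (g : R4 → ℂ) →
    Tendsto (fun ε : ℝ => laplacianPairing (regPotential y ε) (g : R4 → ℂ)) (𝓝[>] 0) (𝓝 (T g))

/-- The hyperplane orthogonal to `y`. -/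
abbrev orthHyperplane (y : R4) : Submodule ℝ R4 := (Submodule.span ℝ {y})ᗮ

/-- The mean `f̄(ρ, ζ)` of `f(ρ σ + ζ ŷ)`, `ŷ = y / |y|`, over `σ` in the unit sphere of the
hyperplane orthogonal to `y`, with respect to the normalized surface measure. (The average `⨍`
divides by the total mass, so that the choice of the Haar measure does not matter.) -/
def sphereMean (y : R4) (f : R4 → ℂ) (ρ ζ : ℝ) : ℂ :=
  ⨍ σ : Metric.sphere (0 : orthHyperplane y) 1,
    f (ρ • ((σ : orthHyperplane y) : R4) + ζ • (‖y‖⁻¹ • y))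
      ∂((Measure.addHaar : Measure (orthHyperplane y)).toSphere)

end ComplexSource

end

noncomputable section

namespace ComplexSource

/-! In cylindrical coordinates x = h + ζŷ with h ⊥ y and r = |h|, the complex square is r² + (ζ +
ia)² = (r − a + iζ)(r + a − iζ). Hence γ vanishes only on the branch sphere r = a, ζ = 0, and r/γ²
splits into half the difference of the Cauchy kernels 1/(r − a + iζ) and 1/(−r − a + iζ).

On a slice ζ ≠ 0 the kernel 1/γ² is smooth and radial on the three-dimensional hyperplane.
Integration by parts removes the angular part of the Laplacian, and r²(G'' + 2G'/r) = r(rG)'' leaves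
r/γ² integrated against the plane Laplacian of u = rG(rσ, ζ)
(`integral_inv_norm_sq_add_mul_laplacian_add`). That Laplacian is odd under (σ, r) ↦ (−σ, −r), so
the two Cauchy kernels on the half line r > 0 unfold to one on the whole line
(`integral_toSphere_Ioi_odd`).

For each σ there remains the plane integral of Δu/(r − a + iζ). Since Δ = (∂_r + i∂_ζ)(∂_r − i∂_ζ),
Cauchy–Pompeiu (`integral_laplacian_div`) evaluates it as −2π(∂_r − i∂_ζ)u at (a, 0), that is −2π(G
+ aG_r − iaG_ζ). The constants combine to 1/(4π), the normalization of the sphere average.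

The potential is locally integrable and dominates its regularizations, so dominated convergence
identifies the limit with the pairing against φ. The sphere formula is bounded on C¹, and test
functions are dense there (`exists_testFunction_approx`), whence uniqueness. Differentiation under
the integral turns the formula into derivatives of the spherical mean. -/

/-! ### The Cauchy–Pompeiu formula in the plane. -/

theorem exists_radius_fderiv_eq_zero {h : ℝ × ℝ → ℂ} (hs : HasCompactSupport h) :
    ∃ R : ℝ, 0 < R ∧ ∀ ρ θ : ℝ, R < |ρ| →
      h (ρ * Real.cos θ, ρ * Real.sin θ) = 0 ∧
      fderiv ℝ h (ρ * Real.cos θ, ρ * Real.sin θ) = 0 := by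
  obtain ⟨R, hR0, hR⟩ := hs.isCompact.isBounded.subset_closedBall_lt 0 (0 : ℝ × ℝ)
  -- The norm on `ℝ × ℝ` is the sup norm: its ball of radius R reaches Euclidean radius √2 R, which
  -- is less than 2R.
  refine ⟨2 * R, by positivity, fun ρ θ hρ => ?_⟩
  have hout : (ρ * Real.cos θ, ρ * Real.sin θ) ∉ tsupport h := by
    intro hmem
    have h1 := hR hmem
    rw [mem_closedBall_zero_iff, Prod.norm_def, sup_le_iff, Real.norm_eq_abs, Real.norm_eq_abs]
      at h1
    obtain ⟨h1, h2⟩ := h1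
    have e1 := sq_le_sq' (abs_le.mp h1).1 (abs_le.mp h1).2
    have e2 := sq_le_sq' (abs_le.mp h2).1 (abs_le.mp h2).2
    have e3 : ρ ^ 2 = (ρ * Real.cos θ) ^ 2 + (ρ * Real.sin θ) ^ 2 := by
      have := Real.sin_sq_add_cos_sq θ
      linear_combination (-ρ ^ 2) * this
    have e4 : (2 * R) ^ 2 < ρ ^ 2 := by
      rw [← sq_abs ρ]
      gcongr
    nlinarith
  exact ⟨image_eq_zero_of_notMem_tsupport hout,
    image_eq_zero_of_notMem_tsupport fun hmem => hout (tsupport_fderiv_subset ℝ hmem)⟩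

theorem hasDerivAt_ray {h : ℝ × ℝ → ℂ} (hc : ContDiff ℝ 1 h) (ρ θ : ℝ) :
    HasDerivAt (fun ρ : ℝ => h (ρ * Real.cos θ, ρ * Real.sin θ))
      (fderiv ℝ h (ρ * Real.cos θ, ρ * Real.sin θ) (Real.cos θ, Real.sin θ)) ρ := by
  have h1 := (hc.differentiable one_ne_zero (ρ * Real.cos θ, ρ * Real.sin θ)).hasFDerivAt
  have h2 : HasDerivAt (fun ρ : ℝ => (ρ * Real.cos θ, ρ * Real.sin θ))
      (Real.cos θ, Real.sin θ) ρ := by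
    simpa using ((hasDerivAt_id ρ).mul_const (Real.cos θ)).prodMk
      ((hasDerivAt_id ρ).mul_const (Real.sin θ))
  exact h1.comp_hasDerivAt ρ h2

theorem hasDerivAt_arc {h : ℝ × ℝ → ℂ} (hc : ContDiff ℝ 1 h) (ρ θ : ℝ) :
    HasDerivAt (fun θ : ℝ => h (ρ * Real.cos θ, ρ * Real.sin θ))
      (ρ • fderiv ℝ h (ρ * Real.cos θ, ρ * Real.sin θ) (-Real.sin θ, Real.cos θ)) θ := by
  have h1 := (hc.differentiable one_ne_zero (ρ * Real.cos θ, ρ * Real.sin θ)).hasFDerivAt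
  have h2 : HasDerivAt (fun θ : ℝ => (ρ * Real.cos θ, ρ * Real.sin θ))
      (ρ • (-Real.sin θ, Real.cos θ)) θ := by
    simpa using ((Real.hasDerivAt_cos θ).const_mul ρ).prodMk
      ((Real.hasDerivAt_sin θ).const_mul ρ)
  have := h1.comp_hasDerivAt θ h2
  rwa [map_smul] at this

theorem integrableOn_polar_target {A : ℝ × ℝ → ℂ} (hA : Continuous A) {R : ℝ}
    (hR : ∀ ρ θ : ℝ, R < |ρ| → A (ρ, θ) = 0) :
    IntegrableOn A (Set.Ioi 0 ×ˢ Set.Ioo (-Real.pi) Real.pi) := by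
  have hK : IsCompact (Set.Icc (0 : ℝ) R ×ˢ Set.Icc (-Real.pi) Real.pi) :=
    isCompact_Icc.prod isCompact_Icc
  refine (hA.continuousOn.integrableOn_compact hK).of_forall_sdiff_eq_zero
    (measurableSet_Ioi.prod measurableSet_Ioo) ?_
  rintro ⟨ρ, θ⟩ ⟨⟨h1, h2⟩, h3⟩
  apply hR
  simp only [Set.mem_Ioi, Set.mem_Ioo, Set.mem_prod, Set.mem_Icc, not_and, not_le] at h1 h2 h3
  rw [abs_of_pos h1]
  by_contra! h4
  exact absurd h2.2.le (not_le.mpr (h3 ⟨h1.le, h4⟩ h2.1.le))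

/-- The Cauchy–Pompeiu formula for compactly supported functions on the plane, at the origin. -/
theorem integral_dbar_div {h : ℝ × ℝ → ℂ} (hc : ContDiff ℝ 1 h) (hs : HasCompactSupport h) :
    ∫ p : ℝ × ℝ, (fderiv ℝ h p (1, 0) + Complex.I * fderiv ℝ h p (0, 1)) /
      ((p.1 : ℂ) + p.2 * Complex.I) = -(2 * Real.pi) * h 0 := by
  obtain ⟨R, hR0, hR⟩ := exists_radius_fderiv_eq_zero hs
  have hcf : Continuous (fderiv ℝ h) := hc.continuous_fderiv one_ne_zero
  set A : ℝ × ℝ → ℂ := fun q => fderiv ℝ h (q.1 * Real.cos q.2, q.1 * Real.sin q.2)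
    (Real.cos q.2, Real.sin q.2) with hA
  set B : ℝ × ℝ → ℂ := fun q => fderiv ℝ h (q.1 * Real.cos q.2, q.1 * Real.sin q.2)
    (-Real.sin q.2, Real.cos q.2) with hB
  have hAc : Continuous A := by
    refine (hcf.comp (by fun_prop)).clm_apply (by fun_prop)
  have hBc : Continuous B := by
    refine (hcf.comp (by fun_prop)).clm_apply (by fun_prop)
  have hAi := integrableOn_polar_target hAc (R := R) fun ρ θ hρ => by simp [hA, (hR ρ θ hρ).2]
  have hBi := integrableOn_polar_target hBc (R := R) fun ρ θ hρ => by simp [hB, (hR ρ θ hρ).2]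
  rw [← integral_comp_polarCoord_symm, polarCoord_target]
  -- In polar coordinates ∂_x + i∂_y = e^{iθ}(∂_ρ + (i/ρ)∂_θ). The Jacobian ρ and the phase cancel
  -- the denominator ρe^{iθ}.
  have hcongr : ∀ q ∈ Set.Ioi (0 : ℝ) ×ˢ Set.Ioo (-Real.pi) Real.pi,
      q.1 • ((fderiv ℝ h (polarCoord.symm q) (1, 0) +
        Complex.I * fderiv ℝ h (polarCoord.symm q) (0, 1)) /
        (((polarCoord.symm q).1 : ℂ) + (polarCoord.symm q).2 * Complex.I)) =
      A q + Complex.I * B q := by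
    rintro ⟨ρ, θ⟩ ⟨hρ, -⟩
    have hρ' : (ρ : ℂ) ≠ 0 := by exact_mod_cast (ne_of_gt hρ : ρ ≠ 0)
    simp only [polarCoord_symm_apply, hA, hB]
    set D := fderiv ℝ h (ρ * Real.cos θ, ρ * Real.sin θ)
    have e1 : ((Real.cos θ, Real.sin θ) : ℝ × ℝ) =
        Real.cos θ • ((1, 0) : ℝ × ℝ) + Real.sin θ • ((0, 1) : ℝ × ℝ) := by simp
    have e2 : ((-Real.sin θ, Real.cos θ) : ℝ × ℝ) =
        (-Real.sin θ) • ((1, 0) : ℝ × ℝ) + Real.cos θ • ((0, 1) : ℝ × ℝ) := by simp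
    rw [e1, e2, map_add, map_add, map_smul, map_smul, map_smul, map_smul]
    simp only [Complex.real_smul]
    have hcs : (Real.cos θ : ℂ) ^ 2 + (Real.sin θ : ℂ) ^ 2 = 1 := by
      exact_mod_cast Real.cos_sq_add_sin_sq θ
    have hne : ((Real.cos θ : ℂ) + Real.sin θ * Complex.I) ≠ 0 := by
      intro h0
      have : ((Real.cos θ : ℂ) + Real.sin θ * Complex.I) *
          (Real.cos θ - Real.sin θ * Complex.I) = 1 := by
        linear_combination hcs - (Real.sin θ : ℂ) ^ 2 * Complex.I_sq
      rw [h0, zero_mul] at this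
      exact zero_ne_one this
    have hden : ((ρ * Real.cos θ : ℝ) : ℂ) + ((ρ * Real.sin θ : ℝ) : ℂ) * Complex.I =
        ρ * ((Real.cos θ : ℂ) + Real.sin θ * Complex.I) := by push_cast; ring
    rw [hden, mul_div_assoc', mul_div_mul_left _ _ hρ', div_eq_iff hne]
    push_cast at hcs ⊢
    generalize D (1, 0) = X
    generalize D (0, 1) = Y
    linear_combination (-X - Complex.I * Y) * hcs - (Complex.sin θ * Complex.cos θ * Y
      - Complex.sin θ ^ 2 * X) * Complex.I_sq
  rw [setIntegral_congr_fun (measurableSet_Ioi.prod measurableSet_Ioo) hcongr]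
  rw [integral_add hAi (hBi.const_mul _), integral_const_mul]
  -- On every ray the fundamental theorem of calculus gives −h(0); the angles contribute the length
  -- 2π.
  have hIA : ∫ q in Set.Ioi (0 : ℝ) ×ˢ Set.Ioo (-Real.pi) Real.pi, A q = -(2 * Real.pi) * h 0 := by
    rw [Measure.volume_eq_prod, ← Measure.prod_restrict] at *
    rw [integral_prod_symm _ (by simpa [IntegrableOn, Measure.prod_restrict] using hAi)]
    have : ∀ θ : ℝ, ∫ ρ in Set.Ioi (0 : ℝ), A (ρ, θ) = -h 0 := by
      intro θ
      have hcs : HasCompactSupport (fun ρ : ℝ => h (ρ * Real.cos θ, ρ * Real.sin θ)) := by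
        refine HasCompactSupport.intro (isCompact_Icc (a := -R) (b := R)) fun ρ hρ => ?_
        refine (hR ρ θ ?_).1
        by_contra! h4
        exact hρ (abs_le.mp h4)
      have hcd : ContDiff ℝ 1 (fun ρ : ℝ => h (ρ * Real.cos θ, ρ * Real.sin θ)) := by
        exact hc.comp (by fun_prop)
      have := hcs.integral_Ioi_deriv_eq hcd 0
      simp only [(hasDerivAt_ray hc _ θ).deriv] at this
      rw [show (0 : ℝ × ℝ) = (0, 0) from rfl]
      simpa only [hA, zero_mul] using this
    simp only [this]
    rw [setIntegral_const]
    rw [Real.volume_real_Ioo_of_le (by linarith [Real.pi_pos]), Complex.real_smul]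
    push_cast
    ring
  -- ρB is the θ-derivative of a 2π-periodic function.
  have hIB : ∫ q in Set.Ioi (0 : ℝ) ×ˢ Set.Ioo (-Real.pi) Real.pi, B q = 0 := by
    rw [Measure.volume_eq_prod, ← Measure.prod_restrict] at *
    rw [integral_prod _ (by simpa [IntegrableOn, Measure.prod_restrict] using hBi)]
    refine setIntegral_eq_zero_of_forall_eq_zero fun ρ hρ => ?_
    rw [← integral_Ioc_eq_integral_Ioo,
      ← intervalIntegral.integral_of_le (by linarith [Real.pi_pos])]
    have hi : IntervalIntegrable (fun θ => ρ • B (ρ, θ)) volume (-Real.pi) Real.pi :=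
      (Continuous.intervalIntegrable (by fun_prop) _ _)
    have := intervalIntegral.integral_eq_sub_of_hasDerivAt (fun θ _ => hasDerivAt_arc hc ρ θ) hi
    rw [intervalIntegral.integral_smul] at this
    simpa [hB, (ne_of_gt hρ : ρ ≠ 0)] using this
  rw [hIA, hIB]
  simp

theorem norm_le_norm_add_mul_I (p : ℝ × ℝ) : ‖p‖ ≤ ‖(p.1 : ℂ) + p.2 * Complex.I‖ := by
  rw [Prod.norm_def, sup_le_iff]
  constructor
  · simpa using Complex.abs_re_le_norm ((p.1 : ℂ) + p.2 * Complex.I)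
  · simpa using Complex.abs_im_le_norm ((p.1 : ℂ) + p.2 * Complex.I)

/-- |p|⁻¹ is locally integrable because the exponent 1 is below the dimension 2; the pole is then
translated to (a, 0). -/
theorem locallyIntegrable_inv_plane (a : ℝ) :
    LocallyIntegrable (fun p : ℝ × ℝ => (((p.1 - a : ℝ) : ℂ) + p.2 * Complex.I)⁻¹) := by
  have h0 : LocallyIntegrable (fun p : ℝ × ℝ => ((p.1 : ℂ) + p.2 * Complex.I)⁻¹) := by
    refine locallyIntegrable_of_norm_le_rpow (C := 1) (α := 1) (by simp) (by simp) ?_ ?_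
    · filter_upwards [Measure.ae_ne volume (0 : ℝ × ℝ)] with p hp
      rw [norm_inv, one_mul, Real.rpow_neg_one]
      exact inv_anti₀ (norm_pos_iff.mpr hp) (norm_le_norm_add_mul_I p)
    · exact Measurable.aestronglyMeasurable (by fun_prop)
  have h1 := (locallyIntegrable_map_homeomorph (Homeomorph.addRight (-(a, 0) : ℝ × ℝ))
    (μ := volume) (f := fun p : ℝ × ℝ => ((p.1 : ℂ) + p.2 * Complex.I)⁻¹)).mp ?_
  · have h2 : (fun p : ℝ × ℝ => (((p.1 - a : ℝ) : ℂ) + p.2 * Complex.I)⁻¹) =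
        (fun p : ℝ × ℝ => ((p.1 : ℂ) + p.2 * Complex.I)⁻¹) ∘
          Homeomorph.addRight (-(a, 0) : ℝ × ℝ) := by
      ext p
      simp [sub_eq_add_neg]
    rwa [h2]
  · rw [Homeomorph.coe_addRight, map_add_right_eq_self]
    exact h0

/-- The Newtonian form of the Cauchy–Pompeiu formula: integrating the Laplacian of `u` against
`1 / (p - (a, 0))` gives the Wirtinger derivative of `u` at `(a, 0)`. -/
theorem integral_laplacian_div {u : ℝ × ℝ → ℂ} (hc : ContDiff ℝ 2 u) (hs : HasCompactSupport u)
    (a : ℝ) :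
    ∫ p : ℝ × ℝ, (((p.1 - a : ℝ) : ℂ) + p.2 * Complex.I)⁻¹ *
      (fderiv ℝ (fderiv ℝ u) p (1, 0) (1, 0) + fderiv ℝ (fderiv ℝ u) p (0, 1) (0, 1)) =
    -(2 * Real.pi) * (fderiv ℝ u (a, 0) (1, 0) - Complex.I * fderiv ℝ u (a, 0) (0, 1)) := by
  have hc1 : ContDiff ℝ 1 (fderiv ℝ u) := hc.fderiv_right (by norm_num)
  -- With h = (∂_x − i∂_y)u, the operator ∂_x + i∂_y applied to h gives Δu, the mixed terms
  -- cancelling by symmetry. The shift moves the pole to the origin.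
  set h : ℝ × ℝ → ℂ := fun p => fderiv ℝ u (p + (a, 0)) (1, 0) -
    Complex.I * fderiv ℝ u (p + (a, 0)) (0, 1) with hh
  have hhc : ContDiff ℝ 1 h := by
    have : ContDiff ℝ 1 (fun p : ℝ × ℝ => fderiv ℝ u (p + (a, 0))) := hc1.comp (by fun_prop)
    exact (this.clm_apply contDiff_const).sub (contDiff_const.mul (this.clm_apply contDiff_const))
  have hhs : HasCompactSupport h := by
    have : HasCompactSupport (fun p : ℝ × ℝ => fderiv ℝ u (p + (a, 0))) :=
      (hs.fderiv ℝ).comp_homeomorph (Homeomorph.addRight ((a, 0) : ℝ × ℝ))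
    exact this.comp_left (g := fun L : ℝ × ℝ →L[ℝ] ℂ => L (1, 0) - Complex.I * L (0, 1)) (by simp)
  have hd : ∀ p v, fderiv ℝ h p v = fderiv ℝ (fderiv ℝ u) (p + (a, 0)) v (1, 0) -
      Complex.I * fderiv ℝ (fderiv ℝ u) (p + (a, 0)) v (0, 1) := by
    intro p v
    have h1 : HasFDerivAt (fun p : ℝ × ℝ => fderiv ℝ u (p + (a, 0)))
        (fderiv ℝ (fderiv ℝ u) (p + (a, 0))) p :=
      (hasFDerivAt_comp_add_right _).mpr
        (hc1.differentiable one_ne_zero (p + (a, 0))).hasFDerivAt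
    have h2 := (h1.clm_apply (hasFDerivAt_const ((1, 0) : ℝ × ℝ) p)).sub
      ((h1.clm_apply (hasFDerivAt_const ((0, 1) : ℝ × ℝ) p)).const_mul Complex.I)
    have h3 : HasFDerivAt h _ p := h2
    rw [h3.fderiv]
    simp
  have key := integral_dbar_div hhc hhs
  rw [← integral_add_right_eq_self _ ((a, 0) : ℝ × ℝ)]
  have h0 : h 0 = fderiv ℝ u (a, 0) (1, 0) - Complex.I * fderiv ℝ u (a, 0) (0, 1) := by
    simp [hh]
  rw [← h0, ← key]
  congr 1
  ext p
  have hsymm : fderiv ℝ (fderiv ℝ u) (p + (a, 0)) (1, 0) (0, 1) =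
      fderiv ℝ (fderiv ℝ u) (p + (a, 0)) (0, 1) (1, 0) :=
    (hc.contDiffAt.isSymmSndFDerivAt (by simp)) _ _
  rw [hd, hd, hsymm, div_eq_inv_mul]
  simp only [Prod.fst_add, Prod.snd_add, add_sub_cancel_right, add_zero]
  congr 1
  linear_combination fderiv ℝ (fderiv ℝ u) (p + (a, 0)) (0, 1) (0, 1) * Complex.I_sq

/-! ### Polar coordinates on a normed space. -/

section Polar

variable {H : Type*} [NormedAddCommGroup H] [NormedSpace ℝ H] [FiniteDimensional ℝ H]
  [MeasurableSpace H] [BorelSpace H] [Nontrivial H] (μ : Measure H) [μ.IsAddHaarMeasure]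

/-- Integration in polar coordinates on a finite-dimensional normed space. -/
theorem integral_eq_integral_toSphere {E : Type*} [NormedAddCommGroup E] [NormedSpace ℝ E]
    {f : H → E} (hf : Integrable f μ) :
    ∫ x, f x ∂μ = ∫ σ : Metric.sphere (0 : H) 1, (∫ r in Set.Ioi (0 : ℝ),
      r ^ (Module.finrank ℝ H - 1) • f (r • (σ : H))) ∂μ.toSphere := by
  have hmp := (μ.measurePreserving_homeomorphUnitSphereProd).symm
    (homeomorphUnitSphereProd H).toMeasurableEquiv
  have hemb := (homeomorphUnitSphereProd H).toMeasurableEquiv.symm.measurableEmbedding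
  have hint : Integrable (fun x : ({0}ᶜ : Set H) => f x) (μ.comap (↑)) := by
    have := (integrableOn_iff_comap_subtypeVal (f := f) (μ := μ)
      (measurableSet_singleton (0 : H)).compl).mp hf.integrableOn
    exact this
  have hint2 := (hmp.integrable_comp_emb hemb).mpr hint
  calc ∫ x, f x ∂μ = ∫ x : ({0}ᶜ : Set H), f x ∂(μ.comap (↑)) := by
        rw [integral_subtype_comap (measurableSet_singleton _).compl f, restrict_compl_singleton]
    _ = ∫ p : Metric.sphere (0 : H) 1 × Set.Ioi (0 : ℝ), f ((p.2 : ℝ) • (p.1 : H))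
          ∂(μ.toSphere.prod (.volumeIoiPow (Module.finrank ℝ H - 1))) := by
        rw [← hmp.integral_comp hemb]
        rfl
    _ = ∫ σ : Metric.sphere (0 : H) 1, (∫ r : Set.Ioi (0 : ℝ), f ((r : ℝ) • (σ : H))
          ∂(.volumeIoiPow (Module.finrank ℝ H - 1))) ∂μ.toSphere :=
        integral_prod _ hint2
    _ = _ := by
        refine integral_congr_ae (.of_forall fun σ => ?_)
        simp only [Measure.volumeIoiPow, ENNReal.ofReal]
        rw [integral_withDensity_eq_integral_smul
          ((measurable_subtype_coe.pow_const _).real_toNNReal),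
          integral_subtype_comap measurableSet_Ioi fun r : ℝ =>
            Real.toNNReal (r ^ (Module.finrank ℝ H - 1)) • f (r • (σ : H))]
        refine setIntegral_congr_fun measurableSet_Ioi fun r hr => ?_
        rw [NNReal.smul_def, Real.coe_toNNReal _ (pow_nonneg (le_of_lt hr) _)]

/-- The version needed to prove local integrability, before any integrability is available. -/
theorem lintegral_eq_lintegral_toSphere {f : H → ENNReal} (hf : Measurable f) :
    ∫⁻ x, f x ∂μ = ∫⁻ σ : Metric.sphere (0 : H) 1, (∫⁻ r in Set.Ioi (0 : ℝ),
      ENNReal.ofReal (r ^ (Module.finrank ℝ H - 1)) * f (r • (σ : H))) ∂μ.toSphere := by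
  have hmp := (μ.measurePreserving_homeomorphUnitSphereProd).symm
    (homeomorphUnitSphereProd H).toMeasurableEquiv
  have hemb := (homeomorphUnitSphereProd H).toMeasurableEquiv.symm.measurableEmbedding
  calc ∫⁻ x, f x ∂μ = ∫⁻ x : ({0}ᶜ : Set H), f x ∂(μ.comap (↑)) := by
        rw [lintegral_subtype_comap (measurableSet_singleton _).compl f, restrict_compl_singleton]
    _ = ∫⁻ p : Metric.sphere (0 : H) 1 × Set.Ioi (0 : ℝ), f ((p.2 : ℝ) • (p.1 : H))
          ∂(μ.toSphere.prod (.volumeIoiPow (Module.finrank ℝ H - 1))) := by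
        rw [← hmp.lintegral_comp_emb hemb]
        rfl
    _ = ∫⁻ σ : Metric.sphere (0 : H) 1, (∫⁻ r : Set.Ioi (0 : ℝ), f ((r : ℝ) • (σ : H))
          ∂(.volumeIoiPow (Module.finrank ℝ H - 1))) ∂μ.toSphere :=
        lintegral_prod _ (by fun_prop)
    _ = _ := by
        refine lintegral_congr fun σ => ?_
        simp only [Measure.volumeIoiPow]
        rw [lintegral_withDensity_eq_lintegral_mul _ (by fun_prop) (by fun_prop),
          ← lintegral_subtype_comap measurableSet_Ioi fun r : ℝ =>
            ENNReal.ofReal (r ^ (Module.finrank ℝ H - 1)) * f (r • (σ : H))]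
        rfl

end Polar

-- The sphere measure of a set comes from the volume of the cone over it, and Haar measure is
-- invariant under negation.
open scoped Pointwise in
theorem measurePreserving_neg_toSphere {H : Type*} [NormedAddCommGroup H] [NormedSpace ℝ H]
    [FiniteDimensional ℝ H] [MeasurableSpace H] [BorelSpace H] (μ : Measure H) [μ.IsAddHaarMeasure] :
    MeasurePreserving (fun σ : Metric.sphere (0 : H) 1 => -σ) μ.toSphere μ.toSphere := by
  have hm : Measurable (fun σ : Metric.sphere (0 : H) 1 => -σ) := continuous_neg.measurable
  refine ⟨hm, Measure.ext fun s hs => ?_⟩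
  rw [Measure.map_apply hm hs, Measure.toSphere_apply' _ (hm hs), Measure.toSphere_apply' _ hs]
  congr 1
  rw [← Measure.measure_neg μ (Set.Ioo (0 : ℝ) 1 • (Subtype.val '' s))]
  congr 1
  ext x
  simp only [Set.mem_smul, Set.mem_neg, Set.mem_image, Set.mem_preimage]
  constructor
  · rintro ⟨r, hr, -, ⟨σ, hσ, rfl⟩, rfl⟩
    exact ⟨r, hr, _, ⟨-σ, hσ, rfl⟩, by simp⟩
  · rintro ⟨r, hr, -, ⟨σ, hσ, rfl⟩, hx⟩
    exact ⟨r, hr, _, ⟨-σ, by simpa using hσ, rfl⟩, by simp [hx]⟩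

/-! ### Derivatives of a composition with an affine map. -/

section Affine

variable {E F V : Type*} [NormedAddCommGroup E] [NormedSpace ℝ E] [NormedAddCommGroup F]
  [NormedSpace ℝ F] [NormedAddCommGroup V] [NormedSpace ℝ V]

theorem fderiv_comp_affine {G : F → V} (hG : Differentiable ℝ G) (L : E →L[ℝ] F) (c : F) (x v : E) :
    fderiv ℝ (fun x => G (L x + c)) x v = fderiv ℝ G (L x + c) (L v) := by
  have h := (hG (L x + c)).hasFDerivAt.comp x (L.hasFDerivAt.add_const c)
  have h' : HasFDerivAt (fun x => G (L x + c)) _ x := h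
  rw [h'.fderiv]
  rfl

theorem fderiv_fderiv_comp_affine {G : F → V} (hG : ContDiff ℝ 2 G) (L : E →L[ℝ] F) (c : F)
    (x v w : E) : fderiv ℝ (fderiv ℝ (fun x => G (L x + c))) x v w =
      fderiv ℝ (fderiv ℝ G) (L x + c) (L v) (L w) := by
  have hd : ContDiff ℝ 1 (fderiv ℝ G) := hG.fderiv_right (by norm_num)
  have h1 : fderiv ℝ (fun x => G (L x + c)) = fun x => (fderiv ℝ G (L x + c)).comp L := by
    ext x v
    exact fderiv_comp_affine (hG.differentiable two_ne_zero) L c x v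
  have h2 : HasFDerivAt (fun x => fderiv ℝ G (L x + c))
      ((fderiv ℝ (fderiv ℝ G) (L x + c)).comp L) x :=
    (hd.differentiable one_ne_zero (L x + c)).hasFDerivAt.comp x (L.hasFDerivAt.add_const c)
  have h3 := ((ContinuousLinearMap.compL ℝ E F V).flip L).hasFDerivAt.comp x h2
  have h4 : HasFDerivAt (fun x => (fderiv ℝ G (L x + c)).comp L) _ x := h3
  rw [h1, h4.fderiv]
  rfl

theorem continuous_fderiv_fderiv {G : F → V} (hG : ContDiff ℝ 2 G) :
    Continuous (fderiv ℝ (fderiv ℝ G)) :=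
  (hG.fderiv_right (m := 1) (by norm_num)).continuous_fderiv one_ne_zero

end Affine

/-! ### The radial kernel 1/(|x|² + c) on a slice, with c off the real axis. -/

section Slice

theorem sq_add_ne_zero {c : ℂ} (hc : c.im ≠ 0) (t : ℝ) : (t : ℂ) ^ 2 + c ≠ 0 := by
  intro h
  have := congrArg Complex.im h
  rw [← Complex.ofReal_pow, Complex.add_im, Complex.ofReal_im] at this
  simp at this
  exact hc this

/-- With Φ = 1/(r² + c), the two integrands differ by the derivative of r²ΦG', which vanishes at 0
and has compact support. The function k is a passenger; it will carry the axial second derivative.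
-/
theorem integral_Ioi_radial_by_parts {c : ℂ} (hc : c.im ≠ 0) {G : ℝ → ℂ} (hG : ContDiff ℝ 2 G)
    (hs : HasCompactSupport G) {k : ℝ → ℂ} (hk : Continuous k) (hks : HasCompactSupport k) :
    ∫ r in Set.Ioi (0 : ℝ), (r : ℂ) ^ 2 * (2 * ((r : ℂ) ^ 2 + c)⁻¹ ^ 2 * (r * deriv G r)
        + ((r : ℂ) ^ 2 + c)⁻¹ * k r) =
      ∫ r in Set.Ioi (0 : ℝ), r * ((r : ℂ) ^ 2 + c)⁻¹ *
        (2 * deriv G r + r * (deriv (deriv G) r + k r)) := by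
  have hG1 : ContDiff ℝ 1 (deriv G) := by
    have : ContDiff ℝ (1 + 1) G := by simpa [one_add_one_eq_two] using hG
    exact (contDiff_succ_iff_deriv.mp this).2.2
  have hG2 : Continuous (deriv (deriv G)) := hG1.continuous_deriv le_rfl
  have hΦc : Continuous (fun r : ℝ => ((r : ℂ) ^ 2 + c)⁻¹) :=
    Continuous.inv₀ (by fun_prop) fun x => sq_add_ne_zero hc x
  set F : ℝ → ℂ := fun r => (r : ℂ) ^ 2 * ((r : ℂ) ^ 2 + c)⁻¹ * deriv G r with hF
  have hFs : HasCompactSupport F := hs.deriv.mul_left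
  have hd1 : ∀ r : ℝ, HasDerivAt (fun r : ℝ => (r : ℂ) ^ 2) (2 * r) r := fun r => by
    have := (Complex.ofRealCLM.hasDerivAt (x := r)).pow 2
    convert! this using 1
    simp
  have hdF : ∀ r : ℝ, HasDerivAt F ((2 * r * ((r : ℂ) ^ 2 + c)⁻¹ + (r : ℂ) ^ 2 *
      (-(2 * r) / ((r : ℂ) ^ 2 + c) ^ 2)) * deriv G r +
      (r : ℂ) ^ 2 * ((r : ℂ) ^ 2 + c)⁻¹ * deriv (deriv G) r) r := fun r =>
    ((hd1 r).mul (((hd1 r).add_const c).inv (sq_add_ne_zero hc r))).mul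
      (hG1.differentiable one_ne_zero r).hasDerivAt
  have hFc : ContDiff ℝ 1 F := by
    have h1 : ContDiff ℝ 1 (fun r : ℝ => (r : ℂ) ^ 2) := Complex.ofRealCLM.contDiff.pow 2
    exact (h1.mul ((h1.add contDiff_const).inv fun r => sq_add_ne_zero hc r)).mul hG1
  have hzero := hFs.integral_Ioi_deriv_eq hFc 0
  have hF0 : F 0 = 0 := by simp [hF]
  rw [hF0, neg_zero] at hzero
  rw [← sub_eq_zero, ← integral_sub]
  · rw [← neg_eq_zero, ← hzero, ← integral_neg]
    congr 1
    ext r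
    rw [(hdF r).deriv]
    field_simp [sq_add_ne_zero hc r]
    ring
  · refine (Continuous.integrable_of_hasCompactSupport ?_ ?_).integrableOn
    · have := hG1.continuous
      fun_prop
    · refine HasCompactSupport.mul_left (HasCompactSupport.add ?_ hks.mul_left)
      exact HasCompactSupport.mul_left (HasCompactSupport.mul_left hs.deriv)
  · refine (Continuous.integrable_of_hasCompactSupport ?_ ?_).integrableOn
    · have := hG1.continuous
      fun_prop
    · refine HasCompactSupport.mul_left (HasCompactSupport.add hs.deriv.mul_left ?_)
      exact HasCompactSupport.mul_left (HasCompactSupport.add hs.deriv.deriv hks)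

variable {H : Type*} [NormedAddCommGroup H] [InnerProductSpace ℝ H]

theorem hasFDerivAt_inv_norm_sq_add {c : ℂ} (hc : c.im ≠ 0) (x : H) :
    HasFDerivAt (fun x : H => ((‖x‖ : ℂ) ^ 2 + c)⁻¹)
      ((-((‖x‖ : ℂ) ^ 2 + c)⁻¹ ^ 2) • (Complex.ofRealCLM.comp (2 • innerSL ℝ x))) x := by
  have h1 : HasFDerivAt (fun x : H => ‖x‖ ^ 2) (2 • innerSL ℝ x) x :=
    (hasStrictFDerivAt_norm_sq x).hasFDerivAt
  have h2 : HasFDerivAt (fun x : H => ((‖x‖ : ℂ) ^ 2 + c))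
      (Complex.ofRealCLM.comp (2 • innerSL ℝ x)) x := by
    have := (Complex.ofRealCLM.hasFDerivAt.comp x h1).add_const c
    convert! this using 2 with y
    simp
  have h3 := (hasDerivAt_inv (sq_add_ne_zero hc ‖x‖)).comp_hasFDerivAt x h2
  convert! h3 using 2
  simp

theorem continuous_inv_norm_sq_add {H : Type*} [NormedAddCommGroup H] {c : ℂ} (hc : c.im ≠ 0) :
    Continuous (fun x : H => ((‖x‖ : ℂ) ^ 2 + c)⁻¹) :=
  Continuous.inv₀ (by fun_prop) fun x => sq_add_ne_zero hc ‖x‖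

theorem hasCompactSupport_comp_smul_unit {E : Type*} [Zero E] {g : H → E}
    (hs : HasCompactSupport g) {σ : H} (hσ : ‖σ‖ = 1) :
    HasCompactSupport (fun r : ℝ => g (r • σ)) := by
  have : Topology.IsClosedEmbedding (fun r : ℝ => r • σ) := by
    refine Isometry.isClosedEmbedding (Isometry.of_dist_eq fun r s => ?_)
    rw [dist_eq_norm, ← sub_smul, norm_smul, hσ, mul_one, ← dist_eq_norm]
  exact hs.comp_isClosedEmbedding this

variable [FiniteDimensional ℝ H] [MeasurableSpace H] [BorelSpace H]
  (μ : Measure H) [μ.IsAddHaarMeasure]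

/-- Integration by parts in each basis direction. The gradient −2Φ²x of Φ = 1/(|x|² + c) is radial,
so only the derivative of g along x survives. -/
theorem integral_inv_norm_sq_add_mul_laplacian {ι : Type*} [Fintype ι] (b : OrthonormalBasis ι ℝ H)
    {c : ℂ} (hc : c.im ≠ 0) {g : H → ℂ} (hg : ContDiff ℝ 2 g) (hgs : HasCompactSupport g) :
    ∫ x, ((‖x‖ : ℂ) ^ 2 + c)⁻¹ * ∑ i, fderiv ℝ (fderiv ℝ g) x (b i) (b i) ∂μ =
      ∫ x, 2 * ((‖x‖ : ℂ) ^ 2 + c)⁻¹ ^ 2 * fderiv ℝ g x x ∂μ := by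
  have hΦc := continuous_inv_norm_sq_add (H := H) hc
  have hg1 : ContDiff ℝ 1 (fderiv ℝ g) := hg.fderiv_right (by norm_num)
  have hg2 := continuous_fderiv_fderiv hg
  have hs1 : HasCompactSupport (fderiv ℝ g) := hgs.fderiv ℝ
  have hs2 : HasCompactSupport (fderiv ℝ (fderiv ℝ g)) := hs1.fderiv ℝ
  have hi1 : ∀ i, Integrable (fun x => ((‖x‖ : ℂ) ^ 2 + c)⁻¹ *
      fderiv ℝ (fderiv ℝ g) x (b i) (b i)) μ := fun i =>
    (hΦc.mul ((hg2.clm_apply continuous_const).clm_apply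
      continuous_const)).integrable_of_hasCompactSupport
      (HasCompactSupport.mul_left
        (hs2.comp_left (g := fun A : H →L[ℝ] H →L[ℝ] ℂ => A (b i) (b i)) (by simp)))
  have hi2 : ∀ i, Integrable (fun x => 2 * ((‖x‖ : ℂ) ^ 2 + c)⁻¹ ^ 2 * ⟪x, b i⟫_ℝ *
      fderiv ℝ g x (b i)) μ := fun i =>
    Continuous.integrable_of_hasCompactSupport
      (Continuous.mul (by fun_prop) (hg1.continuous.clm_apply continuous_const))
      (HasCompactSupport.mul_left
        (hs1.comp_left (g := fun A : H →L[ℝ] ℂ => A (b i)) (by simp)))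
  have hi3 : ∀ i, Integrable (fun x => ((‖x‖ : ℂ) ^ 2 + c)⁻¹ * fderiv ℝ g x (b i)) μ := fun i =>
    Continuous.integrable_of_hasCompactSupport
      (Continuous.mul (by fun_prop) (hg1.continuous.clm_apply continuous_const))
      (HasCompactSupport.mul_left
        (hs1.comp_left (g := fun A : H →L[ℝ] ℂ => A (b i)) (by simp)))
  have hd : ∀ i x, fderiv ℝ (fun x => fderiv ℝ g x (b i)) x (b i) =
      fderiv ℝ (fderiv ℝ g) x (b i) (b i) := fun i x => by
    have := ((hg1.differentiable one_ne_zero x).hasFDerivAt.clm_apply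
      (hasFDerivAt_const (b i) x)).fderiv
    rw [this]
    simp
  have hΦd : ∀ i x, fderiv ℝ (fun x : H => ((‖x‖ : ℂ) ^ 2 + c)⁻¹) x (b i) * fderiv ℝ g x (b i) =
      -(2 * ((‖x‖ : ℂ) ^ 2 + c)⁻¹ ^ 2 * ⟪x, b i⟫_ℝ * fderiv ℝ g x (b i)) := fun i x => by
    rw [(hasFDerivAt_inv_norm_sq_add hc x).fderiv]
    simp only [_root_.smul_apply, ContinuousLinearMap.comp_apply,
      innerSL_apply_apply, Complex.ofRealCLM_apply, smul_eq_mul, nsmul_eq_mul]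
    push_cast
    ring
  have hstep : ∀ i, ∫ x, ((‖x‖ : ℂ) ^ 2 + c)⁻¹ * fderiv ℝ (fderiv ℝ g) x (b i) (b i) ∂μ =
      ∫ x, 2 * ((‖x‖ : ℂ) ^ 2 + c)⁻¹ ^ 2 * ⟪x, b i⟫_ℝ * fderiv ℝ g x (b i) ∂μ := by
    intro i
    have := integral_mul_fderiv_eq_neg_fderiv_mul_of_integrable (μ := μ) (v := b i)
      (f := fun x : H => ((‖x‖ : ℂ) ^ 2 + c)⁻¹) (g := fun x => fderiv ℝ g x (b i))
      (by simp only [hΦd]; exact (hi2 i).neg) (by simp only [hd]; exact hi1 i) (hi3 i)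
      (fun x _ => (hasFDerivAt_inv_norm_sq_add hc x).differentiableAt)
      (fun x _ => (hg1.clm_apply contDiff_const).differentiable one_ne_zero x)
    simp only [hd, hΦd, integral_neg, neg_neg] at this
    exact this
  simp only [Finset.mul_sum]
  rw [integral_finsetSum _ fun i _ => hi1 i, Finset.sum_congr rfl fun i _ => hstep i,
    ← integral_finsetSum _ fun i _ => hi2 i]
  congr 1
  ext x
  have hx : fderiv ℝ g x x = ∑ i, ⟪b i, x⟫_ℝ • fderiv ℝ g x (b i) := by
    conv_lhs => rw [← b.sum_repr' x, map_sum]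
    simp only [map_smul, b.sum_repr' x]
  rw [hx, Finset.mul_sum]
  refine Finset.sum_congr rfl fun i _ => ?_
  rw [Complex.real_smul, real_inner_comm]
  ring

/-- Integrating `Δg` against the radial kernel `1 / (|x|² + c)` in three dimensions, in polar
coordinates: the angular part of the Laplacian drops out. -/
theorem integral_inv_norm_sq_add_mul_laplacian_add (hH : Module.finrank ℝ H = 3)
    {ι : Type*} [Fintype ι] (b : OrthonormalBasis ι ℝ H)
    {c : ℂ} (hc : c.im ≠ 0) {g : H → ℂ} (hg : ContDiff ℝ 2 g) (hgs : HasCompactSupport g)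
    {k : H → ℂ} (hk : Continuous k) (hks : HasCompactSupport k) :
    ∫ x, ((‖x‖ : ℂ) ^ 2 + c)⁻¹ * (∑ i, fderiv ℝ (fderiv ℝ g) x (b i) (b i) + k x) ∂μ =
      ∫ σ : Metric.sphere (0 : H) 1, (∫ r in Set.Ioi (0 : ℝ), r * ((r : ℂ) ^ 2 + c)⁻¹ *
        (2 * fderiv ℝ g (r • (σ : H)) σ + r * (fderiv ℝ (fderiv ℝ g) (r • (σ : H)) σ σ +
          k (r • (σ : H))))) ∂μ.toSphere := by
  have : Nontrivial H := Module.nontrivial_of_finrank_pos (R := ℝ) (by omega)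
  have hΦc := continuous_inv_norm_sq_add (H := H) hc
  have hg1 : ContDiff ℝ 1 (fderiv ℝ g) := hg.fderiv_right (by norm_num)
  have hg2 := continuous_fderiv_fderiv hg
  have hs1 : HasCompactSupport (fderiv ℝ g) := hgs.fderiv ℝ
  have hs2 : HasCompactSupport (fderiv ℝ (fderiv ℝ g)) := hs1.fderiv ℝ
  have hi1 : Integrable (fun x => ((‖x‖ : ℂ) ^ 2 + c)⁻¹ *
      ∑ i, fderiv ℝ (fderiv ℝ g) x (b i) (b i)) μ :=
    (hΦc.mul (continuous_finsetSum _ fun i _ => (hg2.clm_apply continuous_const).clm_apply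
      continuous_const)).integrable_of_hasCompactSupport
      (HasCompactSupport.mul_left
        (hs2.comp_left (g := fun A : H →L[ℝ] H →L[ℝ] ℂ => ∑ i, A (b i) (b i)) (by simp)))
  have hi2 : Integrable (fun x => ((‖x‖ : ℂ) ^ 2 + c)⁻¹ * k x) μ :=
    (hΦc.mul hk).integrable_of_hasCompactSupport hks.mul_left
  have hi3 : Integrable (fun x => 2 * ((‖x‖ : ℂ) ^ 2 + c)⁻¹ ^ 2 * fderiv ℝ g x x) μ := by
    refine Continuous.integrable_of_hasCompactSupport
      (Continuous.mul (by fun_prop) (hg1.continuous.clm_apply continuous_id)) ?_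
    refine HasCompactSupport.mul_left (hs1.mono fun x hx => ?_)
    contrapose! hx
    simp [Function.notMem_support.mp hx]
  simp only [mul_add _ (∑ i, _)]
  rw [integral_add hi1 hi2, integral_inv_norm_sq_add_mul_laplacian μ b hc hg hgs,
    ← integral_add hi3 hi2, integral_eq_integral_toSphere μ (f := fun x => 2 * ((‖x‖ : ℂ) ^ 2 + c)⁻¹ ^ 2 * fderiv ℝ g x x +
      ((‖x‖ : ℂ) ^ 2 + c)⁻¹ * k x) (hi3.add hi2), hH]
  refine integral_congr_ae (.of_forall fun σ => ?_)
  have hσ : ‖(σ : H)‖ = 1 := norm_eq_of_mem_sphere σ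
  have hd1 : ∀ r : ℝ, deriv (fun r : ℝ => g (r • (σ : H))) r = fderiv ℝ g (r • (σ : H)) σ := by
    intro r
    have := fderiv_comp_affine (hg.differentiable two_ne_zero)
      (ContinuousLinearMap.toSpanSingleton ℝ (σ : H)) 0 r 1
    simpa only [ContinuousLinearMap.toSpanSingleton_apply, add_zero, one_smul,
      fderiv_apply_one_eq_deriv] using this
  have hd2 : ∀ r : ℝ, deriv (deriv (fun r : ℝ => g (r • (σ : H)))) r =
      fderiv ℝ (fderiv ℝ g) (r • (σ : H)) σ σ := by
    intro r
    have h1 : HasDerivAt (fun r : ℝ => r • (σ : H)) σ r := by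
      simpa using (hasDerivAt_id r).smul_const (σ : H)
    have h2 : HasFDerivAt (fun x => fderiv ℝ g x (σ : H))
        ((fderiv ℝ (fderiv ℝ g) (r • (σ : H))).flip (σ : H)) (r • (σ : H)) := by
      have := (hg1.differentiable one_ne_zero (r • (σ : H))).hasFDerivAt.clm_apply
        (hasFDerivAt_const (σ : H) (r • (σ : H)))
      simpa using this
    rw [funext hd1]
    exact (h2.comp_hasDerivAt r h1).deriv
  have hGc : ContDiff ℝ 2 (fun r : ℝ => g (r • (σ : H))) :=
    hg.comp (contDiff_id.smul contDiff_const)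
  -- The Cartesian integration by parts is undone along each ray. Its weight r² is the polar
  -- Jacobian of dimension 3, so exactly the radial part of the Laplacian returns.
  have key := integral_Ioi_radial_by_parts hc (G := fun r : ℝ => g (r • (σ : H)))
    hGc (hasCompactSupport_comp_smul_unit hgs hσ)
    (k := fun r : ℝ => k (r • (σ : H)))
    (hk.comp (continuous_id.smul continuous_const)) (hasCompactSupport_comp_smul_unit hks hσ)
  simp only [hd1, hd2] at key
  refine Eq.trans ?_ key
  refine setIntegral_congr_fun measurableSet_Ioi fun r hr => ?_
  have hn : ‖r • (σ : H)‖ = r := by rw [norm_smul, hσ, mul_one, Real.norm_of_nonneg (le_of_lt hr)]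
  simp only [hn, map_smul, Complex.real_smul]
  norm_num

end Slice

/-! ### The kernel 1/γ² in cylindrical coordinates and its reduction to the plane. -/

section Cylinder

/-- The kernel `1 / γ²` in the cylindrical coordinates `x = h + ζ ŷ`. -/
def cylinderKernel {H : Type*} [Norm H] (a : ℝ) (p : H × ℝ) : ℂ :=
  ((‖p.1‖ : ℂ) ^ 2 + ((p.2 : ℂ) + a * Complex.I) ^ 2)⁻¹

/-- The complex distance `r - a + i ζ` to the branch sphere, inverted. -/
def planeKernel (a : ℝ) (p : ℝ × ℝ) : ℂ := (((p.1 - a : ℝ) : ℂ) + p.2 * Complex.I)⁻¹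

theorem sq_im_ne_zero {a ζ : ℝ} (ha : a ≠ 0) (hζ : ζ ≠ 0) :
    (((ζ : ℂ) + a * Complex.I) ^ 2).im ≠ 0 := by
  have : (((ζ : ℂ) + a * Complex.I) ^ 2).im = 2 * (ζ * a) := by
    simp [sq]
    ring
  rw [this]
  positivity

theorem planeKernel_ne {a ζ : ℝ} (hζ : ζ ≠ 0) (r : ℝ) :
    ((r - a : ℝ) : ℂ) + ζ * Complex.I ≠ 0 := by
  intro h
  have := congrArg Complex.im h
  simp at this
  exact hζ this

theorem continuous_planeKernel_slice (a : ℝ) {ζ : ℝ} (hζ : ζ ≠ 0) :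
    Continuous (fun r : ℝ => planeKernel a (r, ζ)) :=
  Continuous.inv₀ (by fun_prop) fun r => planeKernel_ne hζ r

/-- Partial fractions for the factorization (r − a + iζ)(r + a − iζ). Written as an odd part in r,
it is ready for unfolding to the whole line. -/
theorem mul_inv_sq_add_eq {a ζ : ℝ} (ha : a ≠ 0) (hζ : ζ ≠ 0) (r : ℝ) :
    (r : ℂ) * ((r : ℂ) ^ 2 + ((ζ : ℂ) + a * Complex.I) ^ 2)⁻¹ =
      1 / 2 * (planeKernel a (r, ζ) - planeKernel a (-r, ζ)) := by
  have h1 := planeKernel_ne (a := a) hζ r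
  have h2 := planeKernel_ne (a := a) hζ (-r)
  have h3 := sq_add_ne_zero (sq_im_ne_zero ha hζ) r
  simp only [planeKernel]
  field_simp
  push_cast
  linear_combination (2 : ℂ) * r * (a ^ 2 + ζ ^ 2) * Complex.I_sq

/-- In the same factorization the second factor has real part r + a ≥ r, so one power of r absorbs
it. -/
theorem norm_cylinder_le {a r : ℝ} (ha : 0 < a) (hr : 0 < r) (ζ : ℝ) :
    r ^ 2 * ‖((r : ℂ) ^ 2 + ((ζ : ℂ) + a * Complex.I) ^ 2)⁻¹‖ ≤ r * ‖planeKernel a (r, ζ)‖ := by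
  have hfac : (r : ℂ) ^ 2 + ((ζ : ℂ) + a * Complex.I) ^ 2 =
      (((r - a : ℝ) : ℂ) + ζ * Complex.I) * (((r + a : ℝ) : ℂ) - ζ * Complex.I) := by
    push_cast
    linear_combination (a ^ 2 + ζ ^ 2 : ℂ) * Complex.I_sq
  have hlow : r ≤ ‖((r + a : ℝ) : ℂ) - ζ * Complex.I‖ := by
    have := Complex.abs_re_le_norm (((r + a : ℝ) : ℂ) - ζ * Complex.I)
    simp only [Complex.sub_re, Complex.ofReal_re, Complex.re_ofReal_mul, Complex.I_re, mul_zero,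
      sub_zero] at this
    rw [abs_of_pos (by linarith)] at this
    linarith
  rw [hfac, mul_inv, norm_mul, planeKernel, norm_inv (((r + a : ℝ) : ℂ) - ζ * Complex.I)]
  have h2 : r * ‖((r + a : ℝ) : ℂ) - ζ * Complex.I‖⁻¹ ≤ 1 := by
    rw [← div_eq_mul_inv]
    exact div_le_one_of_le₀ hlow (norm_nonneg _)
  calc _ = r * ‖(((r - a : ℝ) : ℂ) + ζ * Complex.I)⁻¹‖ *
        (r * ‖((r + a : ℝ) : ℂ) - ζ * Complex.I‖⁻¹) := by ring
    _ ≤ _ := mul_le_of_le_one_right (by positivity) h2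

theorem measurable_planeKernel (a : ℝ) : Measurable (planeKernel a) := by
  unfold planeKernel
  fun_prop

variable {H : Type*} [NormedAddCommGroup H] [InnerProductSpace ℝ H] [FiniteDimensional ℝ H]
  [MeasurableSpace H] [BorelSpace H] (μ : Measure H) [μ.IsAddHaarMeasure]

theorem measurable_cylinderKernel {H : Type*} [NormedAddCommGroup H] [MeasurableSpace H]
    [OpensMeasurableSpace H] (a : ℝ) : Measurable (cylinderKernel (H := H) a) := by
  unfold cylinderKernel
  fun_prop

theorem locallyIntegrable_cylinderKernel (hH : Module.finrank ℝ H = 3) {a : ℝ} (ha : 0 < a) :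
    LocallyIntegrable (cylinderKernel (H := H) a) (μ.prod volume) := by
  have : Nontrivial H := Module.nontrivial_of_finrank_pos (R := ℝ) (by omega)
  rw [locallyIntegrable_iff]
  intro K hK
  obtain ⟨R, hR0, hR⟩ := hK.isBounded.subset_closedBall_lt 0 0
  refine IntegrableOn.mono_set ?_ hR
  refine ⟨(measurable_cylinderKernel a).aestronglyMeasurable, ?_⟩
  have hplane : ∫⁻ p in Metric.closedBall (0 : ℝ × ℝ) R, ‖planeKernel a p‖ₑ < ⊤ :=
    ((locallyIntegrable_inv_plane a).integrableOn_isCompact (isCompact_closedBall 0 R)).2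
  -- The Jacobian r² tames the factor r + a − iζ, and the remaining r is at most R on the ball. Only
  -- the plane kernel's integrable singularity is left.
  have hmain : ∫⁻ p in Metric.closedBall (0 : H × ℝ) R, ‖cylinderKernel a p‖ₑ ∂(μ.prod volume) ≤
      μ.toSphere Set.univ * (ENNReal.ofReal R *
        ∫⁻ p in Metric.closedBall (0 : ℝ × ℝ) R, ‖planeKernel a p‖ₑ) := by
    rw [← lintegral_indicator measurableSet_closedBall]
    have hmi : Measurable ((Metric.closedBall (0 : H × ℝ) R).indicator
        fun p => ‖cylinderKernel a p‖ₑ) :=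
      (measurable_cylinderKernel a).enorm.indicator measurableSet_closedBall
    have hmp : Measurable ((Metric.closedBall (0 : ℝ × ℝ) R).indicator
        fun p => ‖planeKernel a p‖ₑ) :=
      (measurable_planeKernel a).enorm.indicator measurableSet_closedBall
    rw [lintegral_prod_symm _ hmi.aemeasurable, ← lintegral_indicator measurableSet_closedBall,
      Measure.volume_eq_prod, lintegral_prod_symm _ hmp.aemeasurable,
      ← lintegral_const_mul _ (by fun_prop), ← lintegral_const_mul _ (by fun_prop)]
    refine lintegral_mono fun ζ => ?_
    rw [lintegral_eq_lintegral_toSphere μ (by fun_prop), hH]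
    calc _ ≤ ∫⁻ σ : Metric.sphere (0 : H) 1, (ENNReal.ofReal R * ∫⁻ r : ℝ,
          (Metric.closedBall (0 : ℝ × ℝ) R).indicator (fun p => ‖planeKernel a p‖ₑ) (r, ζ))
          ∂μ.toSphere := by
          refine lintegral_mono fun σ => ?_
          rw [← lintegral_const_mul _ (by fun_prop)]
          refine le_trans (setLIntegral_mono (by fun_prop) fun r hr => ?_)
            (setLIntegral_le_lintegral _ _)
          have hr : 0 < r := hr
          have hn : ‖r • (σ : H)‖ = r := by
            rw [norm_smul, norm_eq_of_mem_sphere σ, mul_one, Real.norm_of_nonneg hr.le]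
          by_cases hmem : (r • (σ : H), ζ) ∈ Metric.closedBall (0 : H × ℝ) R
          · have hmem' : ((r, ζ) : ℝ × ℝ) ∈ Metric.closedBall (0 : ℝ × ℝ) R := by
              rw [mem_closedBall_zero_iff, Prod.norm_def] at hmem ⊢
              simpa only [hn, Real.norm_of_nonneg hr.le] using hmem
            have hrR : r ≤ R := by
              rw [mem_closedBall_zero_iff, Prod.norm_def, sup_le_iff] at hmem
              simpa only [hn] using hmem.1
            rw [Set.indicator_of_mem hmem, Set.indicator_of_mem hmem', ← ofReal_norm, ← ofReal_norm,
              ← ENNReal.ofReal_mul (by positivity), ← ENNReal.ofReal_mul hR0.le]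
            refine ENNReal.ofReal_le_ofReal ?_
            have := norm_cylinder_le ha hr ζ
            simp only [cylinderKernel, hn]
            refine this.trans ?_
            gcongr
          · rw [Set.indicator_of_notMem hmem, mul_zero]
            exact zero_le
      _ = _ := by
          rw [lintegral_const, mul_comm]
  exact hmain.trans_lt (ENNReal.mul_lt_top (measure_lt_top _ _)
    (ENNReal.mul_lt_top ENNReal.ofReal_lt_top hplane))

/-- For an odd function on `S × ℝ`, the half-line integral of an odd kernel unfolds to an integral
over the whole line. -/
theorem integral_toSphere_Ioi_odd {κ : ℝ → ℂ} (hκ : Continuous κ)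
    {V : Metric.sphere (0 : H) 1 × ℝ → ℂ} (hV : Continuous V) (hVs : HasCompactSupport V)
    (hodd : ∀ σ r, V (-σ, -r) = -V (σ, r)) :
    ∫ σ, (∫ r in Set.Ioi (0 : ℝ), (κ r - κ (-r)) * V (σ, r)) ∂μ.toSphere =
      ∫ σ, (∫ r, κ r * V (σ, r)) ∂μ.toSphere := by
  have hF : Integrable (fun q : Metric.sphere (0 : H) 1 × ℝ => κ q.2 * V q)
      (μ.toSphere.prod volume) :=
    Continuous.integrable_of_hasCompactSupport (by fun_prop) hVs.mul_left
  have hline : ∀ σ, Integrable (fun r => κ r * V (σ, r)) := fun σ => by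
    refine Continuous.integrable_of_hasCompactSupport (by fun_prop) (HasCompactSupport.mul_left ?_)
    exact hVs.comp_isClosedEmbedding (Topology.IsClosedEmbedding.of_continuous_injective_isClosedMap
      (by fun_prop) (fun r s h => congrArg Prod.snd h)
      (by
        intro s hs
        have : (fun r : ℝ => (σ, r)) '' s = {σ} ×ˢ s := by
          ext ⟨τ, r⟩
          simp [eq_comm, and_comm]
        rw [this]
        exact isClosed_singleton.prod hs))
  have hline' : ∀ σ, Integrable (fun r => κ (-r) * V (σ, r)) := fun σ => by
    have := ((hline (-σ)).comp_neg).neg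
    refine this.congr (.of_forall fun r => ?_)
    have h1 := hodd (-σ) (-r)
    rw [neg_neg, neg_neg] at h1
    simp only [Pi.neg_apply, h1]
    ring
  set P : Metric.sphere (0 : H) 1 → ℂ := fun σ => ∫ r in Set.Ioi (0 : ℝ), κ r * V (σ, r) with hP
  set N : Metric.sphere (0 : H) 1 → ℂ := fun σ => ∫ r in Set.Iic (0 : ℝ), κ r * V (σ, r) with hN
  have hsub : ∀ s : Set ℝ, Integrable (fun σ => ∫ r in s, κ r * V (σ, r)) μ.toSphere := by
    intro s
    have : Integrable (fun q : Metric.sphere (0 : H) 1 × ℝ => κ q.2 * V q)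
        (μ.toSphere.prod (volume.restrict s)) := by
      refine hF.mono_measure ?_
      exact Measure.prod_mono le_rfl Measure.restrict_le_self
    exact this.integral_prod_left
  -- By oddness and r ↦ −r, the term with κ(−r) becomes the negative half line at the antipode −σ.
  -- Invariance of the sphere measure then replaces −σ by σ.
  have hsplit : ∀ σ, ∫ r in Set.Ioi (0 : ℝ), (κ r - κ (-r)) * V (σ, r) = P σ + N (-σ) := by
    intro σ
    simp only [sub_mul]
    rw [integral_sub (hline σ).integrableOn (hline' σ).integrableOn, sub_eq_add_neg]
    congr 1
    rw [← integral_neg, hN]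
    simp only
    have hflip := integral_comp_neg_Ioi (0 : ℝ) fun r => κ r * V (-σ, r)
    rw [neg_zero] at hflip
    rw [← hflip]
    refine setIntegral_congr_fun (by measurability) fun r _ => ?_
    simp only [hodd]
    ring
  have hwhole : ∀ σ, ∫ r, κ r * V (σ, r) = P σ + N σ := by
    intro σ
    rw [← setIntegral_univ, ← Set.Iic_union_Ioi (a := (0 : ℝ)),
      setIntegral_union (by simp) measurableSet_Ioi (hline σ).integrableOn
        (hline σ).integrableOn, add_comm]
  have hneg := measurePreserving_neg_toSphere μ
  have hNneg : ∫ σ, N (-σ) ∂μ.toSphere = ∫ σ, N σ ∂μ.toSphere :=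
    hneg.integral_comp (Homeomorph.neg (Metric.sphere (0 : H) 1)).measurableEmbedding N
  have hNi : Integrable (fun σ => N (-σ)) μ.toSphere :=
    hneg.integrable_comp_of_integrable (hsub _)
  simp only [hsplit, hwhole]
  rw [integral_add (hsub _) hNi, integral_add (hsub _) (hsub _), hNneg]

end Cylinder

/-! ### The function rG(rv, ζ) on the plane spanned by v and the axis. -/

section Meridian

variable {H : Type*} [NormedAddCommGroup H] [InnerProductSpace ℝ H]

/-- The plane Laplacian of `(r, ζ) ↦ r G(r v, ζ)`. -/
def meridianLaplacian (G : H × ℝ → ℂ) (q : H × ℝ × ℝ) : ℂ :=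
  2 * fderiv ℝ G (q.2.1 • q.1, q.2.2) (q.1, 0) +
    q.2.1 * (fderiv ℝ (fderiv ℝ G) (q.2.1 • q.1, q.2.2) (q.1, 0) (q.1, 0) +
      fderiv ℝ (fderiv ℝ G) (q.2.1 • q.1, q.2.2) (0, 1) (0, 1))

theorem continuous_meridianLaplacian {G : H × ℝ → ℂ} (hG : ContDiff ℝ 2 G) :
    Continuous (meridianLaplacian G) := by
  have h1 : Continuous (fderiv ℝ G) := hG.continuous_fderiv two_ne_zero
  have h2 := continuous_fderiv_fderiv hG
  unfold meridianLaplacian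
  fun_prop

/-- The point rv is unchanged, and every term is odd either in the direction v or in the prefactor
r. -/
theorem meridianLaplacian_neg (G : H × ℝ → ℂ) (v : H) (r ζ : ℝ) :
    meridianLaplacian G (-v, -r, ζ) = -meridianLaplacian G (v, r, ζ) := by
  have h : ((-v, 0) : H × ℝ) = -(v, 0) := by simp
  simp only [meridianLaplacian, smul_neg, neg_smul, neg_neg, h, map_neg,
    _root_.neg_apply, Complex.ofReal_neg]
  ring

/-- One radius serves all unit vectors v, because (rv, ζ) and (r, ζ) have the same sup norm. -/
theorem exists_meridianLaplacian_eq_zero {G : H × ℝ → ℂ} (hs : HasCompactSupport G) :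
    ∃ R : ℝ, ∀ v : H, ‖v‖ = 1 → ∀ p : ℝ × ℝ, R < ‖p‖ →
      G (p.1 • v, p.2) = 0 ∧ meridianLaplacian G (v, p) = 0 := by
  obtain ⟨R, hR⟩ := hs.isCompact.isBounded.subset_closedBall (0 : H × ℝ)
  refine ⟨R, fun v hv p hp => ?_⟩
  have hout : (p.1 • v, p.2) ∉ tsupport G := by
    intro hmem
    have h1 := hR hmem
    rw [mem_closedBall_zero_iff, Prod.norm_def] at h1
    simp only [norm_smul, hv, mul_one] at h1
    rw [Prod.norm_def] at hp
    exact absurd h1 (not_le.mpr hp)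
  have hout1 : (p.1 • v, p.2) ∉ tsupport (fderiv ℝ G) := fun h =>
    hout (tsupport_fderiv_subset ℝ h)
  have hout2 : (p.1 • v, p.2) ∉ tsupport (fderiv ℝ (fderiv ℝ G)) := fun h =>
    hout1 (tsupport_fderiv_subset ℝ h)
  refine ⟨image_eq_zero_of_notMem_tsupport hout, ?_⟩
  simp [meridianLaplacian, image_eq_zero_of_notMem_tsupport hout1,
    image_eq_zero_of_notMem_tsupport hout2]

/-- The linear parametrization of the half plane through `v` by cylindrical coordinates. -/
def meridianMap (v : H) : ℝ × ℝ →L[ℝ] H × ℝ :=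
  (ContinuousLinearMap.toSpanSingleton ℝ v).prodMap (ContinuousLinearMap.id ℝ ℝ)

theorem meridianMap_apply (v : H) (p : ℝ × ℝ) : meridianMap v p = (p.1 • v, p.2) := rfl

theorem fst_smul_comp_fderiv {g : ℝ × ℝ → ℂ} (hg : Differentiable ℝ g) (p w : ℝ × ℝ) :
    fderiv ℝ (fun p : ℝ × ℝ => p.1 • g p) p w = p.1 • fderiv ℝ g p w + w.1 • g p := by
  have := (hasFDerivAt_fst (𝕜 := ℝ) (p := p)).smul (hg p).hasFDerivAt
  have h2 : HasFDerivAt (fun p : ℝ × ℝ => p.1 • g p) _ p := this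
  rw [h2.fderiv]
  simp

theorem fst_smul_comp_fderiv_fderiv {g : ℝ × ℝ → ℂ} (hg : ContDiff ℝ 2 g) (p w : ℝ × ℝ) :
    fderiv ℝ (fderiv ℝ (fun p : ℝ × ℝ => p.1 • g p)) p w w =
      p.1 • fderiv ℝ (fderiv ℝ g) p w w + 2 * w.1 • fderiv ℝ g p w := by
  have hu : ContDiff ℝ 2 (fun p : ℝ × ℝ => p.1 • g p) := contDiff_fst.smul hg
  have hd : ∀ {f : ℝ × ℝ → ℂ}, ContDiff ℝ 2 f → HasFDerivAt (fun x => fderiv ℝ f x w)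
      ((fderiv ℝ (fderiv ℝ f) p).flip w) p := by
    intro f hf
    have h1 : ContDiff ℝ 1 (fderiv ℝ f) := hf.fderiv_right (by norm_num)
    have := (h1.differentiable one_ne_zero p).hasFDerivAt.clm_apply (hasFDerivAt_const w p)
    simpa using this
  have h1 := hd hu
  simp only [fst_smul_comp_fderiv (hg.differentiable two_ne_zero)] at h1
  have h2 := ((hasFDerivAt_fst (𝕜 := ℝ) (p := p)).smul (hd hg)).add
    ((hg.differentiable two_ne_zero p).hasFDerivAt.const_smul w.1)
  have h3 := h1.unique h2
  have h4 := congrArg (fun L : ℝ × ℝ →L[ℝ] ℂ => L w) h3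
  simp only [ContinuousLinearMap.flip_apply, add_apply, _root_.smul_apply,
    ContinuousLinearMap.smulRight_apply, ContinuousLinearMap.coe_fst'] at h4
  rw [h4, two_mul, add_assoc]

/-- Product rule: differentiating the prefactor r produces the undifferentiated term of the final
formula. -/
theorem meridian_fderiv {G : H × ℝ → ℂ} (hG : ContDiff ℝ 2 G) (v : H) (a : ℝ) :
    fderiv ℝ (fun p : ℝ × ℝ => p.1 • G (p.1 • v, p.2)) (a, 0) (1, 0) -
      Complex.I * fderiv ℝ (fun p : ℝ × ℝ => p.1 • G (p.1 • v, p.2)) (a, 0) (0, 1) =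
    G (a • v, 0) + a * fderiv ℝ G (a • v, 0) (v, 0) -
      Complex.I * a * fderiv ℝ G (a • v, 0) (0, 1) := by
  have hg : ContDiff ℝ 2 (fun p => G (meridianMap v p + 0)) :=
    hG.comp ((meridianMap v).contDiff.add contDiff_const)
  have hGd := hG.differentiable two_ne_zero
  have hm : ∀ p : ℝ × ℝ, meridianMap v p + 0 = (p.1 • v, p.2) := fun p => by
    rw [meridianMap_apply, add_zero]
  have h1 := fst_smul_comp_fderiv (hg.differentiable two_ne_zero)
  simp only [fderiv_comp_affine hGd] at h1
  simp only [hm] at h1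
  rw [h1, h1]
  simp [meridianMap_apply]
  ring

theorem meridian_fderiv_fderiv {G : H × ℝ → ℂ} (hG : ContDiff ℝ 2 G) (v : H) (p : ℝ × ℝ) :
    fderiv ℝ (fderiv ℝ (fun p : ℝ × ℝ => p.1 • G (p.1 • v, p.2))) p (1, 0) (1, 0) +
      fderiv ℝ (fderiv ℝ (fun p : ℝ × ℝ => p.1 • G (p.1 • v, p.2))) p (0, 1) (0, 1) =
    meridianLaplacian G (v, p) := by
  have hg : ContDiff ℝ 2 (fun p => G (meridianMap v p + 0)) :=
    hG.comp ((meridianMap v).contDiff.add contDiff_const)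
  have hGd := hG.differentiable two_ne_zero
  have hm : ∀ p : ℝ × ℝ, meridianMap v p + 0 = (p.1 • v, p.2) := fun p => by
    rw [meridianMap_apply, add_zero]
  have h1 := fst_smul_comp_fderiv_fderiv hg
  simp only [fderiv_comp_affine hGd, fderiv_fderiv_comp_affine hG] at h1
  simp only [hm] at h1
  rw [h1, h1]
  simp [meridianMap_apply, meridianLaplacian]
  ring

theorem integral_planeKernel_mul_meridianLaplacian {G : H × ℝ → ℂ} (hG : ContDiff ℝ 2 G)
    (hs : HasCompactSupport G) (a : ℝ) {v : H} (hv : ‖v‖ = 1) :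
    ∫ p : ℝ × ℝ, planeKernel a p * meridianLaplacian G (v, p) =
      -(2 * Real.pi) * (G (a • v, 0) + a * fderiv ℝ G (a • v, 0) (v, 0) -
        Complex.I * a * fderiv ℝ G (a • v, 0) (0, 1)) := by
  have hu : ContDiff ℝ 2 (fun p : ℝ × ℝ => p.1 • G (p.1 • v, p.2)) :=
    contDiff_fst.smul (hG.comp (by fun_prop))
  obtain ⟨R, hR⟩ := exists_meridianLaplacian_eq_zero hs
  have hus : HasCompactSupport (fun p : ℝ × ℝ => p.1 • G (p.1 • v, p.2)) := by
    refine HasCompactSupport.intro (isCompact_closedBall (0 : ℝ × ℝ) R) fun p hp => ?_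
    rw [mem_closedBall_zero_iff, not_le] at hp
    simp [(hR v hv p hp).1]
  have := integral_laplacian_div hu hus a
  simp only [meridian_fderiv hG, meridian_fderiv_fderiv hG] at this
  exact this

end Meridian

/-! ### Assembling the slices: Fubini and the plane formula. -/

section Main

variable {H : Type*} [NormedAddCommGroup H] [InnerProductSpace ℝ H] [FiniteDimensional ℝ H]
  [MeasurableSpace H] [BorelSpace H] (μ : Measure H) [μ.IsAddHaarMeasure]

theorem hasCompactSupport_meridianLaplacian {H : Type*} [NormedAddCommGroup H]
    [InnerProductSpace ℝ H] [FiniteDimensional ℝ H] {G : H × ℝ → ℂ} (hs : HasCompactSupport G) :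
    HasCompactSupport (fun q : Metric.sphere (0 : H) 1 × ℝ × ℝ =>
      meridianLaplacian G ((q.1 : H), q.2)) := by
  obtain ⟨R, hR⟩ := exists_meridianLaplacian_eq_zero hs
  refine HasCompactSupport.intro (isCompact_univ.prod (isCompact_closedBall (0 : ℝ × ℝ) R))
    fun q hq => ?_
  refine (hR _ (norm_eq_of_mem_sphere q.1) q.2 ?_).2
  by_contra! h
  exact hq ⟨Set.mem_univ _, mem_closedBall_zero_iff.mpr h⟩

/-- A locally integrable kernel times a bounded function of compact support. This justifies
exchanging the sphere with the whole (r, ζ)-plane, pole included. -/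
theorem integrable_planeKernel_mul_meridianLaplacian {G : H × ℝ → ℂ} (hG : ContDiff ℝ 2 G)
    (hs : HasCompactSupport G) (a : ℝ) :
    Integrable (fun q : Metric.sphere (0 : H) 1 × ℝ × ℝ =>
      planeKernel a q.2 * meridianLaplacian G ((q.1 : H), q.2)) (μ.toSphere.prod volume) := by
  have hc : Continuous (fun q : Metric.sphere (0 : H) 1 × ℝ × ℝ =>
      meridianLaplacian G ((q.1 : H), q.2)) :=
    (continuous_meridianLaplacian hG).comp (by fun_prop)
  obtain ⟨C, hC⟩ := (hasCompactSupport_meridianLaplacian hs).exists_bound_of_continuous hc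
  obtain ⟨R, hR⟩ := exists_meridianLaplacian_eq_zero hs
  have hk : Integrable ((Metric.closedBall (0 : ℝ × ℝ) R).indicator (planeKernel a)) :=
    ((locallyIntegrable_inv_plane a).integrableOn_isCompact
      (isCompact_closedBall 0 R)).integrable_indicator measurableSet_closedBall
  have h1 : Integrable (fun q : Metric.sphere (0 : H) 1 × ℝ × ℝ =>
      (Metric.closedBall (0 : ℝ × ℝ) R).indicator (planeKernel a) q.2)
      (μ.toSphere.prod volume) := hk.comp_snd _
  have h2 := h1.mul_bdd (c := C) hc.aestronglyMeasurable (.of_forall hC)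
  refine h2.congr (.of_forall fun q => ?_)
  by_cases hq : q.2 ∈ Metric.closedBall (0 : ℝ × ℝ) R
  · simp only [Set.indicator_of_mem hq]
  · rw [mem_closedBall_zero_iff, not_le] at hq
    simp only [(hR _ (norm_eq_of_mem_sphere q.1) q.2 hq).2, mul_zero]

theorem integral_slice_cylinderKernel (hH : Module.finrank ℝ H = 3) {ι : Type*} [Fintype ι]
    (b : OrthonormalBasis ι ℝ H) {G : H × ℝ → ℂ} (hG : ContDiff ℝ 2 G)
    (hs : HasCompactSupport G) {a ζ : ℝ} (ha : 0 < a) (hζ : ζ ≠ 0) :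
    ∫ h, cylinderKernel a (h, ζ) * (∑ i, fderiv ℝ (fderiv ℝ G) (h, ζ) (b i, 0) (b i, 0) +
      fderiv ℝ (fderiv ℝ G) (h, ζ) (0, 1) (0, 1)) ∂μ =
    ∫ r : ℝ, ∫ σ : Metric.sphere (0 : H) 1,
      1 / 2 * (planeKernel a (r, ζ) * meridianLaplacian G ((σ : H), r, ζ)) ∂μ.toSphere := by
  have hc := sq_im_ne_zero ha.ne' hζ
  have hemb : Topology.IsClosedEmbedding (fun h : H => (h, ζ)) :=
    Isometry.isClosedEmbedding (Isometry.of_dist_eq fun x y => by simp [Prod.dist_eq])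
  have haff : ∀ h : H, ContinuousLinearMap.inl ℝ H ℝ h + (0, ζ) = (h, ζ) := fun h => by simp
  have hg : ContDiff ℝ 2 (fun h : H => G (h, ζ)) := hG.comp (by fun_prop)
  have hgs : HasCompactSupport (fun h : H => G (h, ζ)) := hs.comp_isClosedEmbedding hemb
  have hd1 : ∀ x v : H, fderiv ℝ (fun h : H => G (h, ζ)) x v = fderiv ℝ G (x, ζ) (v, 0) := by
    intro x v
    have := fderiv_comp_affine (hG.differentiable two_ne_zero) (ContinuousLinearMap.inl ℝ H ℝ)
      (0, ζ) x v
    simp only [haff] at this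
    exact this
  have hd2 : ∀ x v w : H, fderiv ℝ (fderiv ℝ (fun h : H => G (h, ζ))) x v w =
      fderiv ℝ (fderiv ℝ G) (x, ζ) (v, 0) (w, 0) := by
    intro x v w
    have := fderiv_fderiv_comp_affine hG (ContinuousLinearMap.inl ℝ H ℝ) (0, ζ) x v w
    simp only [haff] at this
    exact this
  have hk : Continuous (fun h : H => fderiv ℝ (fderiv ℝ G) (h, ζ) (0, 1) (0, 1)) :=
    (((continuous_fderiv_fderiv hG).comp (by fun_prop : Continuous fun h : H =>
      (h, ζ))).clm_apply continuous_const).clm_apply continuous_const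
  have hks : HasCompactSupport (fun h : H => fderiv ℝ (fderiv ℝ G) (h, ζ) (0, 1) (0, 1)) :=
    (((hs.fderiv ℝ).fderiv ℝ).comp_isClosedEmbedding hemb).comp_left
      (g := fun A : H × ℝ →L[ℝ] H × ℝ →L[ℝ] ℂ => A (0, 1) (0, 1)) (by simp)
  have key := integral_inv_norm_sq_add_mul_laplacian_add μ hH b hc hg hgs hk hks
  simp only [hd1, hd2] at key
  have hVc : Continuous (fun q : Metric.sphere (0 : H) 1 × ℝ =>
      meridianLaplacian G ((q.1 : H), q.2, ζ)) :=
    (continuous_meridianLaplacian hG).comp (by fun_prop)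
  have hVs : HasCompactSupport (fun q : Metric.sphere (0 : H) 1 × ℝ =>
      meridianLaplacian G ((q.1 : H), q.2, ζ)) := by
    obtain ⟨R, hR⟩ := exists_meridianLaplacian_eq_zero hs
    refine HasCompactSupport.intro (isCompact_univ.prod (isCompact_Icc (a := -R) (b := R)))
      fun q hq => (hR _ (norm_eq_of_mem_sphere q.1) (q.2, ζ) ?_).2
    have : R < |q.2| := by
      by_contra! h
      exact hq ⟨Set.mem_univ _, abs_le.mp h⟩
    exact this.trans_le (norm_fst_le (q.2, ζ))
  have hodd := integral_toSphere_Ioi_odd μ (continuous_planeKernel_slice a hζ) hVc hVs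
    fun σ r => meridianLaplacian_neg G _ r ζ
  have hswap : ∫ σ : Metric.sphere (0 : H) 1, (∫ r, planeKernel a (r, ζ) *
        meridianLaplacian G ((σ : H), r, ζ)) ∂μ.toSphere =
      ∫ r, (∫ σ : Metric.sphere (0 : H) 1, planeKernel a (r, ζ) *
        meridianLaplacian G ((σ : H), r, ζ) ∂μ.toSphere) := by
    refine integral_integral_swap_of_hasCompactSupport ?_ ?_
    · have := continuous_planeKernel_slice a hζ
      exact (this.comp continuous_snd).mul hVc
    · exact hVs.mul_left
  simp only [integral_const_mul]
  simp only [integral_const_mul] at hswap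
  simp only [cylinderKernel]
  rw [key, ← hswap, ← hodd, ← integral_const_mul]
  refine integral_congr_ae (.of_forall fun σ => ?_)
  simp only
  rw [← integral_const_mul]
  refine setIntegral_congr_fun measurableSet_Ioi fun r _ => ?_
  simp only [mul_inv_sq_add_eq ha.ne' hζ, meridianLaplacian]
  ring

/-- The Laplacian of the kernel `1 / γ²` in cylindrical coordinates. -/
theorem integral_cylinderKernel_mul_laplacian (hH : Module.finrank ℝ H = 3) {ι : Type*} [Fintype ι]
    (b : OrthonormalBasis ι ℝ H) {G : H × ℝ → ℂ} (hG : ContDiff ℝ 2 G)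
    (hs : HasCompactSupport G) {a : ℝ} (ha : 0 < a) :
    ∫ p, cylinderKernel a p * (∑ i, fderiv ℝ (fderiv ℝ G) p (b i, 0) (b i, 0) +
      fderiv ℝ (fderiv ℝ G) p (0, 1) (0, 1)) ∂(μ.prod volume) =
    -Real.pi * ∫ σ : Metric.sphere (0 : H) 1, (G (a • (σ : H), 0) +
      a * fderiv ℝ G (a • (σ : H), 0) (σ, 0) -
        Complex.I * a * fderiv ℝ G (a • (σ : H), 0) (0, 1)) ∂μ.toSphere := by
  have hGc := continuous_fderiv_fderiv hG
  have hs2 := (hs.fderiv ℝ).fderiv ℝ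
  have hint : Integrable (fun p => cylinderKernel a p *
      (∑ i, fderiv ℝ (fderiv ℝ G) p (b i, 0) (b i, 0) +
      fderiv ℝ (fderiv ℝ G) p (0, 1) (0, 1))) (μ.prod volume) := by
    refine (locallyIntegrable_cylinderKernel μ hH ha).integrable_smul_right_of_hasCompactSupport
      (by fun_prop) ?_
    exact hs2.comp_left (g := fun A : H × ℝ →L[ℝ] H × ℝ →L[ℝ] ℂ =>
      ∑ i, A (b i, 0) (b i, 0) + A (0, 1) (0, 1)) (by simp)
  have hF := integrable_planeKernel_mul_meridianLaplacian μ hG hs a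
  rw [integral_prod_symm _ hint]
  -- The excluded slice ζ = 0 is the only one meeting the branch sphere, and it is null.
  have hae : ∀ᵐ ζ : ℝ, ∫ h, cylinderKernel a (h, ζ) *
      (∑ i, fderiv ℝ (fderiv ℝ G) (h, ζ) (b i, 0) (b i, 0) +
      fderiv ℝ (fderiv ℝ G) (h, ζ) (0, 1) (0, 1)) ∂μ =
      ∫ r : ℝ, ∫ σ : Metric.sphere (0 : H) 1,
      1 / 2 * (planeKernel a (r, ζ) * meridianLaplacian G ((σ : H), r, ζ)) ∂μ.toSphere := by
    filter_upwards [Measure.ae_ne volume (0 : ℝ)] with ζ hζ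
    exact integral_slice_cylinderKernel μ hH b hG hs ha hζ
  rw [integral_congr_ae hae]
  have hF' := hF.const_mul (1 / 2)
  have hplane : Integrable (fun p : ℝ × ℝ => ∫ σ : Metric.sphere (0 : H) 1,
      1 / 2 * (planeKernel a p * meridianLaplacian G ((σ : H), p)) ∂μ.toSphere) :=
    hF'.integral_prod_right
  have h1 := integral_prod_symm _ hplane
  rw [← Measure.volume_eq_prod] at h1
  -- With σ outermost, each inner integral is the plane formula; ½ · (−2π) gives the factor −π.
  rw [← h1, ← integral_integral_swap hF', ← integral_const_mul]
  refine integral_congr_ae (.of_forall fun σ => ?_)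
  simp only
  rw [integral_const_mul, integral_planeKernel_mul_meridianLaplacian hG hs a
    (norm_eq_of_mem_sphere σ)]
  ring

end Main

/-! ### Normalization of the sphere average. -/

section SphereAverage

variable {H : Type*} [NormedAddCommGroup H] [NormedSpace ℝ H] [FiniteDimensional ℝ H]
  [MeasurableSpace H] [BorelSpace H]

theorem toSphere_smul {H : Type*} [NormedAddCommGroup H] [NormedSpace ℝ H]
    [MeasurableSpace H] [BorelSpace H] (c : NNReal) (μ : Measure H) : (c • μ).toSphere = c • μ.toSphere := by
  refine Measure.ext fun s hs => ?_
  rw [Measure.toSphere_apply' _ hs, Measure.smul_apply, Measure.smul_apply,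
    Measure.toSphere_apply' _ hs, ENNReal.smul_def, ENNReal.smul_def, smul_eq_mul, smul_eq_mul,
    mul_left_comm]

/-- The average over the unit sphere does not depend on the choice of the Haar measure. -/
theorem average_toSphere_eq (μ ν : Measure H) [μ.IsAddHaarMeasure] [ν.IsAddHaarMeasure]
    (f : Metric.sphere (0 : H) 1 → ℂ) : ⨍ σ, f σ ∂μ.toSphere = ⨍ σ, f σ ∂ν.toSphere := by
  have h := Measure.isAddLeftInvariant_eq_smul μ ν
  set c := Measure.addHaarScalarFactor μ ν
  have hc : (c : ℝ) ≠ 0 := by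
    exact_mod_cast (Measure.addHaarScalarFactor_pos_of_isAddHaarMeasure μ ν).ne'
  rw [h, toSphere_smul, average_eq, average_eq, integral_smul_nnreal_measure,
    measureReal_nnreal_smul_apply, NNReal.smul_def, smul_smul, mul_inv, mul_right_comm,
    inv_mul_cancel₀ hc, one_mul]

/-- The total mass is the dimension times the volume of the unit ball, 3 · 4π/3. -/
theorem average_toSphere_volume {H : Type*} [NormedAddCommGroup H] [InnerProductSpace ℝ H]
    [FiniteDimensional ℝ H] [MeasurableSpace H] [BorelSpace H] (hH : Module.finrank ℝ H = 3)
    (f : Metric.sphere (0 : H) 1 → ℂ) :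
    ⨍ σ, f σ ∂(volume : Measure H).toSphere =
      1 / (4 * Real.pi) * ∫ σ, f σ ∂(volume : Measure H).toSphere := by
  have hm : (volume : Measure H).toSphere.real Set.univ = 4 * Real.pi := by
    rw [Measure.toSphere_real_apply_univ, hH, Measure.real,
      InnerProductSpace.volume_ball_of_dim_odd (k := 1) (by rw [hH]), hH]
    have : (Nat.doubleFactorial 3 : ℝ) = 3 := by norm_num [Nat.doubleFactorial]
    rw [this, ENNReal.toReal_mul, ENNReal.toReal_ofReal (by positivity)]
    norm_num
    ring
  rw [average_eq, hm, Complex.real_smul]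
  push_cast
  rw [one_div]

end SphereAverage

/-! ### Cylindrical coordinates around y and the potential. -/

section Coordinates

variable (y : R4)

instance : Fact (Module.finrank ℝ R4 = 3 + 1) := ⟨by simp⟩

theorem finrank_orthHyperplane (hy : y ≠ 0) : Module.finrank ℝ (orthHyperplane y) = 3 :=
  Submodule.finrank_orthogonal_span_singleton hy

/-- The unit vector in the direction of `y`. -/
def direction : R4 := ‖y‖⁻¹ • y

theorem norm_direction (hy : y ≠ 0) : ‖direction y‖ = 1 := by
  rw [direction, norm_smul, norm_inv, norm_norm, inv_mul_cancel₀ (norm_ne_zero_iff.mpr hy)]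

theorem inner_orthHyperplane (h : orthHyperplane y) : ⟪y, (h : R4)⟫_ℝ = 0 :=
  Submodule.mem_orthogonal_singleton_iff_inner_right.mp h.2

theorem inner_orthHyperplane_direction (h : orthHyperplane y) :
    ⟪(h : R4), direction y⟫_ℝ = 0 := by
  rw [direction, inner_smul_right, real_inner_comm, inner_orthHyperplane, mul_zero]

theorem norm_add_smul_direction_sq (hy : y ≠ 0) (h : orthHyperplane y) (ζ : ℝ) :
    ‖(h : R4) + ζ • direction y‖ ^ 2 = ‖h‖ ^ 2 + ζ ^ 2 := by
  rw [norm_add_sq_real, inner_smul_right, inner_orthHyperplane_direction, norm_smul,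
    norm_direction y hy]
  simp

/-- Cylindrical coordinates as a linear isometry. -/
def cylinderIsometry (hy : y ≠ 0) : WithLp 2 (orthHyperplane y × ℝ) ≃ₗᵢ[ℝ] R4 :=
  LinearIsometry.toLinearIsometryEquiv
    { toLinearMap := ((orthHyperplane y).subtype.coprod
        (LinearMap.toSpanSingleton ℝ R4 (direction y))) ∘ₗ
          (WithLp.linearEquiv 2 ℝ (orthHyperplane y × ℝ)).toLinearMap
      norm_map' := fun p => by
        rw [← sq_eq_sq₀ (norm_nonneg _) (norm_nonneg _), WithLp.prod_norm_sq_eq_of_L2]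
        have := norm_add_smul_direction_sq y hy p.fst p.snd
        rw [Real.norm_eq_abs p.snd, sq_abs, ← this]
        rfl }
    (by
      rw [(WithLp.linearEquiv 2 ℝ (orthHyperplane y × ℝ)).finrank_eq, Module.finrank_prod,
        finrank_orthHyperplane y hy]
      simp)

/-- Cylindrical coordinates `(h, ζ) ↦ h + ζ ŷ` around the axis `y`. -/
def cylinderEquiv (hy : y ≠ 0) : (orthHyperplane y × ℝ) ≃L[ℝ] R4 :=
  (WithLp.prodContinuousLinearEquiv 2 ℝ (orthHyperplane y) ℝ).symm.trans
    (cylinderIsometry y hy).toContinuousLinearEquiv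

theorem cylinderIsometry_toLp (hy : y ≠ 0) (p : orthHyperplane y × ℝ) :
    cylinderIsometry y hy (WithLp.toLp 2 p) = (p.1 : R4) + p.2 • direction y := rfl

theorem cylinderEquiv_apply (hy : y ≠ 0) (p : orthHyperplane y × ℝ) :
    cylinderEquiv y hy p = (p.1 : R4) + p.2 • direction y := rfl

theorem measurePreserving_cylinderEquiv (hy : y ≠ 0) :
    MeasurePreserving (cylinderEquiv y hy)
      ((volume : Measure (orthHyperplane y)).prod volume) volume :=
  (cylinderIsometry y hy).measurePreserving.comp
    (WithLp.volume_preserving_toLp (orthHyperplane y) ℝ)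

theorem complexSq_eq (x : R4) :
    complexSq y x = (‖x‖ : ℂ) ^ 2 - (‖y‖ : ℂ) ^ 2 + 2 * Complex.I * (⟪y, x⟫_ℝ : ℝ) := by
  have h1 : ∀ x : R4, (‖x‖ : ℂ) ^ 2 = ∑ j, (x j : ℂ) ^ 2 := fun x => by
    rw [← Complex.ofReal_pow, EuclideanSpace.real_norm_sq_eq]
    push_cast
    rfl
  have h2 : ((⟪y, x⟫_ℝ : ℝ) : ℂ) = ∑ j, (x j : ℂ) * y j := by
    rw [PiLp.inner_apply]
    push_cast
    simp
  rw [h1, h1, h2, complexSq, Finset.mul_sum, ← Finset.sum_sub_distrib, ← Finset.sum_add_distrib]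
  refine Finset.sum_congr rfl fun j _ => ?_
  linear_combination (y j : ℂ) ^ 2 * Complex.I_sq

/-- Pythagoras and ⟨y, x⟩ = ζ|y| complete the square in ζ + i|y|. -/
theorem complexSq_cylinder (hy : y ≠ 0) (p : orthHyperplane y × ℝ) :
    complexSq y (cylinderEquiv y hy p) =
      (‖p.1‖ : ℂ) ^ 2 + ((p.2 : ℂ) + ‖y‖ * Complex.I) ^ 2 := by
  have hi : ⟪y, cylinderEquiv y hy p⟫_ℝ = p.2 * ‖y‖ := by
    have hn : ‖y‖ ≠ 0 := norm_ne_zero_iff.mpr hy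
    rw [cylinderEquiv_apply, inner_add_right, inner_orthHyperplane, direction, inner_smul_right,
      inner_smul_right, real_inner_self_eq_norm_sq]
    field_simp
    simp
  rw [complexSq_eq, hi, ← Complex.ofReal_pow, cylinderEquiv_apply, norm_add_smul_direction_sq y hy]
  push_cast
  linear_combination (-(‖y‖ : ℂ) ^ 2) * Complex.I_sq

theorem complexLength_sq (x : R4) : complexLength y x ^ 2 = complexSq y x := by
  simp [complexLength, Complex.sqrt]

theorem potential_eq (x : R4) : potential y x = -(1 / (4 * (Real.pi : ℂ) ^ 2)) * (complexSq y x)⁻¹ := by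
  rw [potential, complexLength_sq, one_div, one_div, mul_inv, neg_mul]

theorem potential_cylinder (hy : y ≠ 0) (p : orthHyperplane y × ℝ) :
    potential y (cylinderEquiv y hy p) =
      -(1 / (4 * (Real.pi : ℂ) ^ 2)) * cylinderKernel ‖y‖ p := by
  rw [potential_eq, complexSq_cylinder, cylinderKernel]

theorem locallyIntegrable_potential (hy : y ≠ 0) : LocallyIntegrable (potential y) := by
  have h := locallyIntegrable_cylinderKernel (volume : Measure (orthHyperplane y))
    (finrank_orthHyperplane y hy) (norm_pos_iff.mpr hy)
  have h2 := (locallyIntegrable_map_homeomorph (cylinderEquiv y hy).toHomeomorph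
    (μ := (volume : Measure (orthHyperplane y)).prod volume) (f := potential y)).mpr ?_
  · have hm := (measurePreserving_cylinderEquiv y hy).map_eq
    rw [← hm]
    exact h2
  · have h3 := h.smul (-(1 / (4 * (Real.pi : ℂ) ^ 2)))
    refine h3.congr (.of_forall fun p => ?_)
    exact (potential_cylinder y hy p).symm

theorem continuous_complexSq : Continuous (complexSq y) := by
  unfold complexSq
  fun_prop

theorem re_complexLength (x : R4) :
    (complexLength y x).re = √((‖complexSq y x‖ + (complexSq y x).re) / 2) := by
  rw [complexLength, Complex.sqrt, Complex.cpow_inv_two_re]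

theorem measurable_regPotential (ε : ℝ) : Measurable (regPotential y ε) := by
  have h1 : Measurable (potential y) := by
    rw [funext (potential_eq y)]
    exact ((continuous_complexSq y).measurable.inv).const_mul _
  have h2 : Measurable (fun x => (complexLength y x).re) := by
    rw [funext (re_complexLength y)]
    have := (continuous_complexSq y).measurable
    fun_prop
  exact Measurable.ite (measurableSet_lt measurable_const h2) h1 measurable_const

theorem norm_regPotential_le (ε : ℝ) (x : R4) : ‖regPotential y ε x‖ ≤ ‖potential y x‖ := by
  rw [regPotential]
  split_ifs <;> simp

theorem locallyIntegrable_regPotential (hy : y ≠ 0) (ε : ℝ) :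
    LocallyIntegrable (regPotential y ε) :=
  (locallyIntegrable_potential y hy).mono (measurable_regPotential y ε).aestronglyMeasurable
    (.of_forall (norm_regPotential_le y ε))

/-- Off the hyperplane orthogonal to `y`, the real part of the complex length is positive. -/
theorem re_complexLength_pos {x : R4} (hx : ⟪y, x⟫_ℝ ≠ 0) : 0 < (complexLength y x).re := by
  rw [re_complexLength, Real.sqrt_pos]
  have him : (complexSq y x).im ≠ 0 := by
    have : (complexSq y x).im = 2 * ⟪y, x⟫_ℝ := by
      rw [complexSq_eq, ← Complex.ofReal_pow, ← Complex.ofReal_pow, Complex.add_im, Complex.sub_im,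
        Complex.ofReal_im, Complex.ofReal_im]
      simp
    rw [this]
    positivity
  have h1 := Complex.abs_re_lt_norm.mpr him
  have h2 := neg_abs_le (complexSq y x).re
  linarith

theorem ae_inner_ne_zero (hy : y ≠ 0) : ∀ᵐ x : R4, ⟪y, x⟫_ℝ ≠ 0 := by
  have h : orthHyperplane y ≠ ⊤ := by
    intro h
    have h1 : y ∈ orthHyperplane y := h ▸ Submodule.mem_top
    have h2 := inner_orthHyperplane y ⟨y, h1⟩
    exact hy (inner_self_eq_zero.mp h2)
  have h0 := Measure.addHaar_submodule (volume : Measure R4) _ h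
  rw [ae_iff]
  refine measure_mono_null (fun x hx => ?_) h0
  simpa [Submodule.mem_orthogonal_singleton_iff_inner_right] using hx

end Coordinates

/-! ### Pairing the potential with a test function. -/

section Pairing

theorem laplacian_eq_sum {ι : Type*} [Fintype ι] (b : OrthonormalBasis ι ℝ R4) (g : R4 → ℂ) :
    Laplacian.laplacian g = fun x => ∑ i, fderiv ℝ (fderiv ℝ g) x (b i) (b i) := by
  ext x
  have := congrFun (InnerProductSpace.laplacian_eq_iteratedFDeriv_orthonormalBasis g b) x
  simpa only [iteratedFDeriv_two_apply, Matrix.cons_val_zero, Matrix.cons_val_one] using this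

theorem continuous_laplacian {g : R4 → ℂ} (hg : ContDiff ℝ 2 g) :
    Continuous (Laplacian.laplacian g) := by
  rw [laplacian_eq_sum (stdOrthonormalBasis ℝ R4) g]
  have := continuous_fderiv_fderiv hg
  fun_prop

theorem hasCompactSupport_laplacian {g : R4 → ℂ} (hs : HasCompactSupport g) :
    HasCompactSupport (Laplacian.laplacian g) := by
  rw [laplacian_eq_sum (stdOrthonormalBasis ℝ R4) g]
  exact ((hs.fderiv ℝ).fderiv ℝ).comp_left (g := fun A : R4 →L[ℝ] R4 →L[ℝ] ℂ =>
    ∑ i, A (stdOrthonormalBasis ℝ R4 i) (stdOrthonormalBasis ℝ R4 i)) (by simp)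

/-- Dominated convergence with majorant |φΔg|: off the null hyperplane ⟨y, x⟩ = 0 the cutoff is
inactive as soon as ε < p. -/
theorem tendsto_laplacianPairing_regPotential {y : R4} (hy : y ≠ 0) {g : R4 → ℂ}
    (hg : ContDiff ℝ 2 g) (hs : HasCompactSupport g) :
    Tendsto (fun ε : ℝ => laplacianPairing (regPotential y ε) g) (𝓝[>] 0)
      (𝓝 (laplacianPairing (potential y) g)) := by
  have hint : Integrable (fun x => potential y x * Laplacian.laplacian g x) :=
    (locallyIntegrable_potential y hy).integrable_smul_right_of_hasCompactSupport
      (continuous_laplacian hg) (hasCompactSupport_laplacian hs)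
  refine tendsto_integral_filter_of_dominated_convergence _ ?_ ?_ hint.norm ?_
  · exact .of_forall fun ε => (measurable_regPotential y ε).aestronglyMeasurable.mul
      (continuous_laplacian hg).aestronglyMeasurable
  · refine .of_forall fun ε => .of_forall fun x => ?_
    rw [norm_mul, norm_mul]
    gcongr
    exact norm_regPotential_le y ε x
  · filter_upwards [ae_inner_ne_zero y hy] with x hx
    refine tendsto_const_nhds.congr' ?_
    have hpos := re_complexLength_pos y hx
    filter_upwards [Ioo_mem_nhdsGT hpos] with ε hε
    rw [regPotential, if_pos hε.2]

theorem laplacianPairing_potential {y : R4} (hy : y ≠ 0) {g : R4 → ℂ}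
    (hg : ContDiff ℝ 2 g) (hs : HasCompactSupport g) :
    laplacianPairing (potential y) g =
      ⨍ σ : Metric.sphere (0 : orthHyperplane y) 1, (g (‖y‖ • ((σ : orthHyperplane y) : R4)) +
        ‖y‖ * fderiv ℝ g (‖y‖ • ((σ : orthHyperplane y) : R4)) ((σ : orthHyperplane y) : R4) -
        Complex.I * ‖y‖ * fderiv ℝ g (‖y‖ • ((σ : orthHyperplane y) : R4)) (direction y))
        ∂(Measure.addHaar : Measure (orthHyperplane y)).toSphere := by
  set T := cylinderEquiv y hy with hT
  set G : orthHyperplane y × ℝ → ℂ := fun p => g (T.toContinuousLinearMap p + 0) with hG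
  have hGc : ContDiff ℝ 2 G := hg.comp (T.toContinuousLinearMap.contDiff.add contDiff_const)
  have hGs : HasCompactSupport G := by
    have : G = g ∘ T.toHomeomorph := by
      ext p
      simp [hG]
    rw [this]
    exact hs.comp_homeomorph T.toHomeomorph
  set e := stdOrthonormalBasis ℝ (orthHyperplane y)
  -- A basis adapted to the splitting, so that the Laplacian separates into hyperplane and axial
  -- parts.
  set b := (e.prod (OrthonormalBasis.singleton Unit ℝ)).map (cylinderIsometry y hy) with hb
  have hb1 : ∀ i, b (Sum.inl i) = T (e i, 0) := fun i => by
    simp [hb, hT, cylinderIsometry_toLp, cylinderEquiv_apply]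
  have hb2 : ∀ i, b (Sum.inr i) = T (0, 1) := fun i => by
    simp [hb, hT, cylinderIsometry_toLp, cylinderEquiv_apply]
  have hlap : ∀ p, Laplacian.laplacian g (T p) = ∑ i, fderiv ℝ (fderiv ℝ G) p (e i, 0) (e i, 0) +
      fderiv ℝ (fderiv ℝ G) p (0, 1) (0, 1) := by
    intro p
    simp only [hG, fderiv_fderiv_comp_affine hg]
    rw [laplacian_eq_sum b]
    simp [hb1, hb2, Fintype.sum_sum_type]
  have hT0 : ∀ σ : Metric.sphere (0 : orthHyperplane y) 1,
      T (‖y‖ • (σ : orthHyperplane y), 0) = ‖y‖ • ((σ : orthHyperplane y) : R4) := fun σ => by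
    simp [hT, cylinderEquiv_apply]
  have hT1 : ∀ σ : Metric.sphere (0 : orthHyperplane y) 1,
      T ((σ : orthHyperplane y), 0) = ((σ : orthHyperplane y) : R4) := fun σ => by
    simp [hT, cylinderEquiv_apply]
  have hT2 : T (0, 1) = direction y := by simp [hT, cylinderEquiv_apply]
  have key := integral_cylinderKernel_mul_laplacian (volume : Measure (orthHyperplane y))
    (finrank_orthHyperplane y hy) e hGc hGs (norm_pos_iff.mpr hy)
  simp only [← hlap] at key
  rw [laplacianPairing, ← (measurePreserving_cylinderEquiv y hy).integral_comp
    T.toHomeomorph.measurableEmbedding]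
  simp only [potential_cylinder, mul_assoc]
  rw [integral_const_mul, key, average_toSphere_eq _ (volume : Measure (orthHyperplane y)),
    average_toSphere_volume (finrank_orthHyperplane y hy), ← mul_assoc]
  congr 1
  -- The constants match: −1/(4π²) · (−π) = 1/(4π).
  · have : (Real.pi : ℂ) ≠ 0 := by exact_mod_cast Real.pi_ne_zero
    field_simp
  · refine integral_congr_ae (.of_forall fun σ => ?_)
    simp only [hG, fderiv_comp_affine (hg.differentiable two_ne_zero)]
    simp [hT0, hT1, hT2, mul_assoc]

end Pairing

/-! ### Derivatives of the spherical mean. -/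

section SphereDerivative

/-- Differentiation under the integral sign along a moving family of lines. -/
theorem hasDerivAt_average_line {S : Type*} [TopologicalSpace S] [CompactSpace S]
    [MeasurableSpace S] [OpensMeasurableSpace S] [SecondCountableTopology S]
    (μ : Measure S) [IsFiniteMeasure μ] {f : R4 → ℂ} (hf : ContDiff ℝ 1 f) {v w : S → R4}
    (hv : Continuous v) (hw : Continuous w) (t : ℝ) :
    HasDerivAt (fun t : ℝ => ⨍ σ, f (t • v σ + w σ) ∂μ)
      (⨍ σ, fderiv ℝ f (t • v σ + w σ) (v σ) ∂μ) t := by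
  have hfd : Continuous (fderiv ℝ f) := hf.continuous_fderiv one_ne_zero
  have hc : Continuous (fun q : ℝ × S => fderiv ℝ f (q.1 • v q.2 + w q.2) (v q.2)) := by fun_prop
  obtain ⟨C, hC⟩ := ((isCompact_closedBall t 1).prod
    (isCompact_univ : IsCompact (Set.univ : Set S))).exists_bound_of_continuousOn hc.continuousOn
  have hint : ∀ {k : S → ℂ}, Continuous k → Integrable k μ := fun hk =>
    hk.integrable_of_hasCompactSupport (HasCompactSupport.of_compactSpace _)
  have hfc := hf.continuous
  have hmain := hasDerivAt_integral_of_dominated_loc_of_deriv_le (μ := μ)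
    (F := fun (t : ℝ) σ => f (t • v σ + w σ))
    (F' := fun (t : ℝ) σ => fderiv ℝ f (t • v σ + w σ) (v σ)) (bound := fun _ => C)
    (Metric.closedBall_mem_nhds t one_pos)
    (.of_forall fun s => (hint (k := fun σ => f (s • v σ + w σ)) (by fun_prop)).1)
    (hint (by fun_prop))
    (hint (k := fun σ => fderiv ℝ f (t • v σ + w σ) (v σ)) (by fun_prop)).1
    (.of_forall fun σ s hs => hC (s, σ) ⟨hs, Set.mem_univ _⟩) (integrable_const _)
    (.of_forall fun σ s _ => by
      have h1 : HasDerivAt (fun s : ℝ => s • v σ + w σ) (v σ) s := by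
        simpa using ((hasDerivAt_id s).smul_const (v σ)).add_const (w σ)
      exact (hf.differentiable one_ne_zero _).hasFDerivAt.comp_hasDerivAt s h1)
  simp only [average_eq]
  exact hmain.2.const_smul _

variable (y : R4)

theorem continuous_sphere_coe :
    Continuous (fun σ : Metric.sphere (0 : orthHyperplane y) 1 => ((σ : orthHyperplane y) : R4)) :=
  continuous_subtype_val.comp continuous_subtype_val

theorem hasDerivAt_sphereMean_radial {f : R4 → ℂ} (hf : ContDiff ℝ 1 f) (ρ : ℝ) :
    HasDerivAt (fun ρ : ℝ => sphereMean y f ρ 0)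
      (⨍ σ : Metric.sphere (0 : orthHyperplane y) 1,
        fderiv ℝ f (ρ • ((σ : orthHyperplane y) : R4)) ((σ : orthHyperplane y) : R4)
        ∂(Measure.addHaar : Measure (orthHyperplane y)).toSphere) ρ := by
  have := hasDerivAt_average_line (Measure.addHaar : Measure (orthHyperplane y)).toSphere hf
    (continuous_sphere_coe y) (w := fun _ => 0) continuous_const ρ
  simpa [sphereMean] using this

theorem hasDerivAt_sphereMean_axial {f : R4 → ℂ} (hf : ContDiff ℝ 1 f) (ρ : ℝ) :
    HasDerivAt (fun ζ : ℝ => sphereMean y f ρ ζ)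
      (⨍ σ : Metric.sphere (0 : orthHyperplane y) 1,
        fderiv ℝ f (ρ • ((σ : orthHyperplane y) : R4)) (direction y)
        ∂(Measure.addHaar : Measure (orthHyperplane y)).toSphere) 0 := by
  have := hasDerivAt_average_line (Measure.addHaar : Measure (orthHyperplane y)).toSphere hf
    (v := fun _ => direction y) continuous_const ((continuous_sphere_coe y).const_smul ρ) 0
  simp only [zero_smul, zero_add, Pi.smul_apply] at this
  simpa only [sphereMean, add_comm, direction] using this

end SphereDerivative

/-! ### The source distribution as a functional on C¹. -/

section Functional

variable (y : R4)

/-- The integrand of the source distribution on the branch sphere. -/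
def sourceDensity (f : R4 → ℂ) (σ : Metric.sphere (0 : orthHyperplane y) 1) : ℂ :=
  f (‖y‖ • ((σ : orthHyperplane y) : R4)) +
    ‖y‖ * fderiv ℝ f (‖y‖ • ((σ : orthHyperplane y) : R4)) ((σ : orthHyperplane y) : R4) -
    Complex.I * ‖y‖ * fderiv ℝ f (‖y‖ • ((σ : orthHyperplane y) : R4)) (direction y)

theorem integrable_sphere {k : Metric.sphere (0 : orthHyperplane y) 1 → ℂ} (hk : Continuous k) :
    Integrable k (Measure.addHaar : Measure (orthHyperplane y)).toSphere :=
  hk.integrable_of_hasCompactSupport (HasCompactSupport.of_compactSpace _)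

theorem continuous_sphere_terms {f : R4 → ℂ} (hf : ContDiff ℝ 1 f) :
    Continuous (fun σ : Metric.sphere (0 : orthHyperplane y) 1 =>
      f (‖y‖ • ((σ : orthHyperplane y) : R4))) ∧
    Continuous (fun σ : Metric.sphere (0 : orthHyperplane y) 1 =>
      fderiv ℝ f (‖y‖ • ((σ : orthHyperplane y) : R4)) ((σ : orthHyperplane y) : R4)) ∧
    Continuous (fun σ : Metric.sphere (0 : orthHyperplane y) 1 =>
      fderiv ℝ f (‖y‖ • ((σ : orthHyperplane y) : R4)) (direction y)) := by
  have h1 := continuous_sphere_coe y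
  have h2 : Continuous (fderiv ℝ f) := hf.continuous_fderiv one_ne_zero
  have h3 := hf.continuous
  refine ⟨?_, ?_, ?_⟩ <;> fun_prop

theorem integrable_sourceDensity {f : R4 → ℂ} (hf : ContDiff ℝ 1 f) :
    Integrable (sourceDensity y f) (Measure.addHaar : Measure (orthHyperplane y)).toSphere := by
  obtain ⟨h1, h2, h3⟩ := continuous_sphere_terms y hf
  exact integrable_sphere y ((h1.add (continuous_const.mul h2)).sub (continuous_const.mul h3))

/-- The source distribution as a linear functional on `C¹`. -/
def sourceFunctional : C1 →ₗ[ℂ] ℂ where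
  toFun f := ⨍ σ, sourceDensity y f σ ∂(Measure.addHaar : Measure (orthHyperplane y)).toSphere
  map_add' f g := by
    have hf : ContDiff ℝ 1 (f : R4 → ℂ) := f.2
    have hg : ContDiff ℝ 1 (g : R4 → ℂ) := g.2
    have h : sourceDensity y ((f + g : C1) : R4 → ℂ) =
        fun σ => sourceDensity y f σ + sourceDensity y g σ := by
      ext σ
      simp only [sourceDensity, Submodule.coe_add,
        fderiv_add (hf.differentiable one_ne_zero _) (hg.differentiable one_ne_zero _),
        Pi.add_apply, _root_.add_apply]
      ring
    rw [h]
    simp only [average_eq]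
    rw [integral_add (integrable_sourceDensity y hf) (integrable_sourceDensity y hg), smul_add]
  map_smul' c f := by
    have hf : ContDiff ℝ 1 (f : R4 → ℂ) := f.2
    have h : sourceDensity y ((c • f : C1) : R4 → ℂ) = fun σ => c * sourceDensity y f σ := by
      ext σ
      simp only [sourceDensity, Submodule.coe_smul,
        fderiv_const_smul (hf.differentiable one_ne_zero _), Pi.smul_apply, _root_.smul_apply,
        smul_eq_mul]
      ring
    rw [h]
    simp only [average_eq]
    rw [integral_const_mul, RingHom.id_apply, smul_eq_mul, mul_smul_comm]

theorem sourceFunctional_apply (f : C1) : sourceFunctional y f =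
    ⨍ σ, sourceDensity y f σ ∂(Measure.addHaar : Measure (orthHyperplane y)).toSphere := rfl

theorem sourceFunctional_eq (f : C1) : sourceFunctional y f = sphereMean y f ‖y‖ 0
    + (‖y‖ : ℂ) * deriv (fun ρ : ℝ => sphereMean y f ρ 0) ‖y‖
    - Complex.I * (‖y‖ : ℂ) * deriv (fun ζ : ℝ => sphereMean y f ‖y‖ ζ) 0 := by
  have hf : ContDiff ℝ 1 (f : R4 → ℂ) := f.2
  obtain ⟨h1, h2, h3⟩ := continuous_sphere_terms y hf
  have hi1 := integrable_sphere y h1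
  have hi2 := (integrable_sphere y h2).const_mul (‖y‖ : ℂ)
  have hi3 := (integrable_sphere y h3).const_mul (Complex.I * ‖y‖)
  rw [(hasDerivAt_sphereMean_radial y hf ‖y‖).deriv, (hasDerivAt_sphereMean_axial y hf ‖y‖).deriv,
    sourceFunctional_apply]
  simp only [sphereMean, zero_smul, add_zero, average_eq, sourceDensity]
  have hi12 : Integrable (fun σ : Metric.sphere (0 : orthHyperplane y) 1 =>
      (f : R4 → ℂ) (‖y‖ • ((σ : orthHyperplane y) : R4)) + ‖y‖ * fderiv ℝ (f : R4 → ℂ)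
        (‖y‖ • ((σ : orthHyperplane y) : R4)) ((σ : orthHyperplane y) : R4))
      (Measure.addHaar : Measure (orthHyperplane y)).toSphere := hi1.add hi2
  rw [integral_sub hi12 hi3, integral_add hi1 hi2, integral_const_mul, integral_const_mul,
    smul_sub, smul_add, mul_smul_comm, mul_smul_comm]

/-- The ball of radius |y| contains the branch sphere. The density has one term of size M and two of
size |y|M, and averaging is against a probability measure. -/
theorem isBoundedOnC1_sourceFunctional (hy : y ≠ 0) : IsBoundedOnC1 (sourceFunctional y) := by
  refine ⟨Metric.closedBall 0 ‖y‖, isCompact_closedBall _ _, 1 + 2 * ‖y‖, fun f M h0 h1 => ?_⟩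
  have hb : ∀ σ, ‖sourceDensity y f σ‖ ≤ (1 + 2 * ‖y‖) * M := by
    intro σ
    have hσ : ‖((σ : orthHyperplane y) : R4)‖ = 1 := norm_eq_of_mem_sphere σ
    have hmem : ‖y‖ • ((σ : orthHyperplane y) : R4) ∈ Metric.closedBall (0 : R4) ‖y‖ := by
      rw [mem_closedBall_zero_iff, norm_smul, hσ, norm_norm, mul_one]
    have e0 := h0 _ hmem
    have e1 := h1 _ hmem
    have e2 := (fderiv ℝ (f : R4 → ℂ) (‖y‖ • ((σ : orthHyperplane y) : R4))).le_of_opNorm_le e1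
      ((σ : orthHyperplane y) : R4)
    have e3 := (fderiv ℝ (f : R4 → ℂ) (‖y‖ • ((σ : orthHyperplane y) : R4))).le_of_opNorm_le e1
      (direction y)
    rw [hσ, mul_one] at e2
    rw [norm_direction y hy, mul_one] at e3
    rw [sourceDensity]
    refine (norm_sub_le _ _).trans ?_
    refine (add_le_add_left (norm_add_le _ _) _).trans ?_
    rw [norm_mul, norm_mul, norm_mul, Complex.norm_I, one_mul, Complex.norm_real, norm_norm]
    nlinarith [norm_nonneg y, mul_le_mul_of_nonneg_left e2 (norm_nonneg y),
      mul_le_mul_of_nonneg_left e3 (norm_nonneg y)]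
  have : Nontrivial (orthHyperplane y) :=
    Module.nontrivial_of_finrank_pos (R := ℝ) (by rw [finrank_orthHyperplane y hy]; norm_num)
  set ν := (Measure.addHaar : Measure (orthHyperplane y)).toSphere
  have hν : NeZero ν := ⟨Measure.toSphere_ne_zero _⟩
  rw [sourceFunctional_apply, average]
  have := norm_integral_le_of_norm_le_const (μ := (ν Set.univ)⁻¹ • ν) (.of_forall hb)
  rwa [probReal_univ, mul_one] at this

end Functional

/-! ### Density of test functions and uniqueness. -/

section Density

/-- Test functions are dense in `C¹` for the seminorms of compact sets. -/
theorem exists_testFunction_approx {f : R4 → ℂ} (hf : ContDiff ℝ 1 f) {K : Set R4}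
    (hK : IsCompact K) {η : ℝ} (hη : 0 < η) :
    ∃ g : R4 → ℂ, ContDiff ℝ ∞ g ∧ HasCompactSupport g ∧
      (∀ x ∈ K, ‖f x - g x‖ ≤ η) ∧ ∀ x ∈ K, ‖fderiv ℝ f x - fderiv ℝ g x‖ ≤ η := by
  obtain ⟨R, hR0, hR⟩ := hK.isBounded.subset_ball_lt 0 (0 : R4)
  -- The cutoff is 1 on a ball that is a neighbourhood of K, so it changes neither f nor Df on K.
  let χ : ContDiffBump (0 : R4) := ⟨R, R + 1, hR0, by linarith⟩
  set ψ : R4 → ℂ := fun x => χ x • f x with hψ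
  have hψc : ContDiff ℝ 1 ψ := χ.contDiff.smul hf
  have hψs : HasCompactSupport ψ := χ.hasCompactSupport.smul_right
  have heq : ∀ x ∈ K, ψ =ᶠ[𝓝 x] f := by
    intro x hx
    filter_upwards [Metric.isOpen_ball.mem_nhds (hR hx)] with z hz
    rw [hψ]
    simp only
    rw [χ.one_of_mem_closedBall (Metric.ball_subset_closedBall hz), one_smul]
  have hu0 := hψs.uniformContinuous_of_continuous hψc.continuous
  have hu1 := (hψs.fderiv ℝ).uniformContinuous_of_continuous (hψc.continuous_fderiv one_ne_zero)
  obtain ⟨d0, hd0, h0⟩ := Metric.uniformContinuous_iff.mp hu0 η hη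
  obtain ⟨d1, hd1, h1⟩ := Metric.uniformContinuous_iff.mp hu1 η hη
  have hd : 0 < min d0 d1 := lt_min hd0 hd1
  -- The mollifier's support is small enough for the moduli of continuity of both ψ and Dψ.
  let φ : ContDiffBump (0 : R4) := ⟨min d0 d1 / 2, min d0 d1, by linarith, by linarith⟩
  have hφs : HasCompactSupport (φ.normed volume) := φ.hasCompactSupport_normed
  have hφc : ContDiff ℝ ∞ (φ.normed (volume : Measure R4)) := φ.contDiff_normed
  set g : R4 → ℂ := convolution (φ.normed volume) ψ (ContinuousLinearMap.lsmul ℝ ℝ) volume with hg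
  -- The derivative falls on ψ, so Dg is the mollification of Dψ and the same estimate applies to
  -- it.
  have hgd : ∀ x, fderiv ℝ g x = convolution (φ.normed volume) (fderiv ℝ ψ)
      (ContinuousLinearMap.lsmul ℝ ℝ) volume x := by
    intro x
    have := hψs.hasFDerivAt_convolution_right (ContinuousLinearMap.lsmul ℝ ℝ) (μ := volume)
      hφc.continuous.locallyIntegrable hψc x
    rw [this.fderiv]
    congr 1
  refine ⟨g, ?_, ?_, ?_, ?_⟩
  · exact hφs.contDiff_convolution_left _ hφc hψc.continuous.locallyIntegrable
  · exact hφs.convolution _ hψs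
  · intro x hx
    have := φ.dist_normed_convolution_le (μ := volume) (g := ψ) (x₀ := x) (ε := η)
      hψc.continuous.aestronglyMeasurable
      fun z hz => (h0 ((Metric.mem_ball.mp hz).trans_le (min_le_left _ _))).le
    rw [(heq x hx).eq_of_nhds, dist_comm, dist_eq_norm] at this
    exact this
  · intro x hx
    have := φ.dist_normed_convolution_le (μ := volume) (g := fderiv ℝ ψ) (x₀ := x) (ε := η)
      (hψc.continuous_fderiv one_ne_zero).aestronglyMeasurable
      fun z hz => (h1 ((Metric.mem_ball.mp hz).trans_le (min_le_right _ _))).le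
    rw [(heq x hx).fderiv_eq, dist_comm, dist_eq_norm] at this
    rw [hgd]
    exact this

/-- Bounded functionals on `C¹` are determined by their values on test functions. -/
theorem eq_of_eq_on_testFunctions {T T' : C1 →ₗ[ℂ] ℂ} (hT : IsBoundedOnC1 T)
    (hT' : IsBoundedOnC1 T') (h : ∀ g : C1, ContDiff ℝ ∞ (g : R4 → ℂ) →
      HasCompactSupport (g : R4 → ℂ) → T g = T' g) : T = T' := by
  obtain ⟨K, hK, C, hC⟩ := hT
  obtain ⟨K', hK', C', hC'⟩ := hT'
  refine LinearMap.ext fun f => ?_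
  have hf : ContDiff ℝ 1 (f : R4 → ℂ) := f.2
  -- Approximating on K ∪ K' serves both seminorms; the functionals agree on g, so only f − g
  -- contributes.
  have hle : ∀ η : ℝ, 0 < η → ‖T f - T' f‖ ≤ (C + C') * η := by
    intro η hη
    obtain ⟨g, hgc, hgs, hg0, hg1⟩ := exists_testFunction_approx hf (hK.union hK') hη
    have hgc1 : ContDiff ℝ 1 g := hgc.of_le (by exact_mod_cast le_top)
    let g' : C1 := ⟨g, hgc1⟩
    have hd : ∀ x, fderiv ℝ ((f - g' : C1) : R4 → ℂ) x = fderiv ℝ f x - fderiv ℝ g x := fun x =>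
      fderiv_sub (hf.differentiable one_ne_zero x) (hgc1.differentiable one_ne_zero x)
    have e1 := hC (f - g') η (fun x hx => hg0 x (.inl hx)) fun x hx => by
      rw [hd]
      exact hg1 x (.inl hx)
    have e2 := hC' (f - g') η (fun x hx => hg0 x (.inr hx)) fun x hx => by
      rw [hd]
      exact hg1 x (.inr hx)
    have e3 : T f - T' f = T (f - g') - T' (f - g') := by
      rw [map_sub, map_sub, h g' hgc hgs]
      ring
    rw [e3, add_mul]
    exact (norm_sub_le _ _).trans (add_le_add e1 e2)
  have hlim : Tendsto (fun η : ℝ => (C + C') * η) (𝓝[>] 0) (𝓝 0) := by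
    have : Tendsto (fun η : ℝ => (C + C') * η) (𝓝 0) (𝓝 ((C + C') * 0)) :=
      tendsto_id.const_mul _
    rw [mul_zero] at this
    exact this.mono_left nhdsWithin_le_nhds
  have hzero : ‖T f - T' f‖ ≤ 0 :=
    ge_of_tendsto hlim (by filter_upwards [self_mem_nhdsWithin] with η hη using hle η hη)
  exact sub_eq_zero.mp (norm_le_zero_iff.mp hzero)

end Density

theorem sourceFunctional_eq_laplacianPairing {y : R4} (hy : y ≠ 0) {g : C1}
    (hg : ContDiff ℝ ∞ (g : R4 → ℂ)) (hs : HasCompactSupport (g : R4 → ℂ)) :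
    sourceFunctional y g = laplacianPairing (potential y) g :=
  (laplacianPairing_potential hy (contDiff_infty.mp hg 2) hs).symm

theorem isSourceDistribution_sourceFunctional {y : R4} (hy : y ≠ 0) :
    IsSourceDistribution y (sourceFunctional y) where
  bounded := isBoundedOnC1_sourceFunctional y hy
  tendsto g hg hs := by
    rw [sourceFunctional_eq_laplacianPairing hy hg hs]
    exact tendsto_laplacianPairing_regPotential hy (contDiff_infty.mp hg 2) hs

end ComplexSource

end

theorem proposition5 (y : ComplexSource.R4) (hy : y ≠ 0) :
    LocallyIntegrable (ComplexSource.potential y) ∧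
    (∀ ε : ℝ, 0 < ε → LocallyIntegrable (ComplexSource.regPotential y ε)) ∧
    ∃ δ : ComplexSource.C1 →ₗ[ℂ] ℂ,
      ComplexSource.IsSourceDistribution y δ ∧
      (∀ δ' : ComplexSource.C1 →ₗ[ℂ] ℂ, ComplexSource.IsSourceDistribution y δ' → δ' = δ) ∧
      (∀ g : ComplexSource.C1, ContDiff ℝ ∞ (g : ComplexSource.R4 → ℂ) →
        HasCompactSupport (g : ComplexSource.R4 → ℂ) →
        δ g = ComplexSource.laplacianPairing (ComplexSource.potential y) g) ∧
      ∀ f : ComplexSource.C1,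
        DifferentiableAt ℝ (fun ρ : ℝ => ComplexSource.sphereMean y f ρ 0) ‖y‖ ∧
        DifferentiableAt ℝ (fun ζ : ℝ => ComplexSource.sphereMean y f ‖y‖ ζ) 0 ∧
        δ f = ComplexSource.sphereMean y f ‖y‖ 0
          + (‖y‖ : ℂ) * deriv (fun ρ : ℝ => ComplexSource.sphereMean y f ρ 0) ‖y‖
          - Complex.I * (‖y‖ : ℂ) * deriv (fun ζ : ℝ => ComplexSource.sphereMean y f ‖y‖ ζ) 0 := by
  have hsource := ComplexSource.isSourceDistribution_sourceFunctional hy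
  refine ⟨ComplexSource.locallyIntegrable_potential y hy,
    fun ε _ => ComplexSource.locallyIntegrable_regPotential y hy ε,
    ComplexSource.sourceFunctional y, hsource, fun δ' hδ' => ?_,
    fun g hg hs => ComplexSource.sourceFunctional_eq_laplacianPairing hy hg hs, fun f => ?_⟩
  · exact ComplexSource.eq_of_eq_on_testFunctions hδ'.bounded hsource.bounded fun g hg hs =>
      tendsto_nhds_unique (hδ'.tendsto g hg hs) (hsource.tendsto g hg hs)
  · have hf : ContDiff ℝ 1 (f : ComplexSource.R4 → ℂ) := f.2
    exact ⟨(ComplexSource.hasDerivAt_sphereMean_radial y hf ‖y‖).differentiableAt,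
      (ComplexSource.hasDerivAt_sphereMean_axial y hf ‖y‖).differentiableAt,
      ComplexSource.sourceFunctional_eq y f⟩
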